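/- **The Insertion-Surplus Problem.** Let $o_1,\dots,o_{2R}$ be a sequence of operations that alternates between insertions and deletions of keys from a universe $U$ (the first operation may be of either kind), and let $h:U\to\{1,\dots,n\}$ be a fully random hash function (its values are independent and uniform). For every $k$, if $o_k$ is an operation on the key $x_k$, place a dot at $(h(x_k),k)$; it is blue if $o_k$ is an insertion and red if $o_k$ is a deletion. The surplus of a monotonic (continuous, upward and rightward) path is the number of blue dots strictly beneath the path minus the number of red dots strictly beneath it. For $1\le i\le j\le n$ let $\mathrm{surplus}([i,j])$ be the maximum surplus of a monotonic path from $(i-1,1)$ to $(j,2R+1)$. **Statement.** For every constant $C$ there is a constant $c>0$, depending only on $C$, such that the following holds. Let $\varepsilon(n)\to0$ as $n\to\infty$. Then for all sufficiently large $n$ (depending on $C$ and on the function $\varepsilon$), for all $R\le Cn$ and $t\le n^{\varepsilon(n)}$ (that is, $R=O(n)$ and $t= n^{o(1)}$) such that $m=\sqrt{tR/n}$ satisfies $m\ge 1$, and for every alternating sequence of $2R$ insertions/deletions in which every operation is on a distinct key: 1. the maximum surplus over all monotonic paths from $(0,1)$ to $(t,2R+1)$ satisfies $$\mathbb E\big[\mathrm{surplus}([1,t])\big]=\mathbb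 E\Big[\max_{P}\mathrm{surplus}(P)\Big]\ \ge\ c\,m\log^{0.75}m;$$ 2. for every interval $[j-t,j]\subseteq[1,n]$, $$\mathbb E\big[\mathrm{surplus}([j-t,j])\big]\ \ge\ c\,m\log^{0.75}m.$$ -/

import Mathlib

open MeasureTheory ProbabilityTheory Filter Topology

/-- An operation on a hash table: the insertion (`isInsertion = true`) or the deletion
(`isInsertion = false`) of a key of the universe `U`. -/
structure Operation (U : Type*) where
  isInsertion : Bool
  key : U

/-- Insertions and deletions alternate (the first operation may be of either kind). -/
def IsAlternating {U : Type*} {N : ℕ} (o : Fin N → Operation U) : Prop :=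
  ∀ i j : Fin N, (j : ℕ) = (i : ℕ) + 1 → (o j).isInsertion ≠ (o i).isInsertion

/-- `h` is a fully random hash function from `U` to `n` slots: the hashes of the keys are
independent and uniform. The element `a : Fin n` stands for slot `a + 1` of `{1, …, n}`. -/
structure IsFullyRandomHash {U Ω : Type*} [MeasurableSpace Ω] (P : Measure Ω) (n : ℕ)
    (h : U → Ω → Fin n) : Prop where
  measurable : ∀ u, Measurable (h u)
  uniform : ∀ u a, P (h u ⁻¹' {a}) = (n : ENNReal)⁻¹
  indep : iIndepFun h P

/-- The dot of the `k`-th operation (counted from `1`, hence the shift of the index of `Fin N`) is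
at `(hash of its key, k)`. -/
def dot {U : Type*} {n N : ℕ} (g : U → Fin n) (o : Fin N → Operation U) (k : Fin N) : ℝ × ℝ :=
  (((g (o k).key : ℕ) : ℝ) + 1, ((k : ℕ) : ℝ) + 1)

/-- Monotonic paths from `p` to `q`: continuous, travelling upwards and to the right. -/
def MonotonePath (p q : ℝ × ℝ) : Type :=
  {γ : Path p q // Monotone γ}

/-- The point `z` lies strictly beneath the path: the path passes over the abscissa of `z`, and
every point of the path with this abscissa is strictly higher than `z`. -/
def StrictlyBeneath {p q : ℝ × ℝ} (γ : MonotonePath p q) (z : ℝ × ℝ) : Prop :=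
  (∃ s, (γ.1 s).1 = z.1) ∧ ∀ s, (γ.1 s).1 = z.1 → z.2 < (γ.1 s).2

open Classical in
/-- The surplus of a path: the number of blue dots (insertions) strictly beneath it minus the number
of red dots (deletions) strictly beneath it. -/
noncomputable def pathSurplus {U : Type*} {n N : ℕ} (g : U → Fin n) (o : Fin N → Operation U)
    {p q : ℝ × ℝ} (γ : MonotonePath p q) : ℤ :=
  ((Finset.univ.filter fun k : Fin N =>
      (o k).isInsertion = true ∧ StrictlyBeneath γ (dot g o k)).card : ℤ) -
    ((Finset.univ.filter fun k : Fin N =>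
      (o k).isInsertion = false ∧ StrictlyBeneath γ (dot g o k)).card : ℤ)

/-- The surplus of the interval `[i, j]` of slots: the maximum surplus of a monotonic path from
`(i - 1, 1)` to `(j, N + 1)`, where `N` is the number of operations. -/
noncomputable def intervalSurplus {U : Type*} {n N : ℕ} (g : U → Fin n) (o : Fin N → Operation U)
    (i j : ℕ) : ℤ :=
  ⨆ γ : MonotonePath ((i : ℝ) - 1, (1 : ℝ)) ((j : ℝ), (N : ℝ) + 1), pathSurplus g o γ

theorem monotonePath_nonempty {p q : ℝ × ℝ} (hpq : p ≤ q) : Nonempty (MonotonePath p q) := by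
  refine ⟨⟨⟨⟨fun s => p + (s : ℝ) • (q - p), by fun_prop⟩, by simp, by simp⟩, ?_⟩⟩
  intro s s' hs
  have h0 : (0 : ℝ × ℝ) ≤ q - p := sub_nonneg.2 hpq
  have h1 : (s : ℝ) ≤ s' := hs
  change p + (s : ℝ) • (q - p) ≤ p + (s' : ℝ) • (q - p)
  gcongr

theorem pathSurplus_le {U : Type*} {n N : ℕ} (g : U → Fin n) (o : Fin N → Operation U)
    {p q : ℝ × ℝ} (γ : MonotonePath p q) : pathSurplus g o γ ≤ N := by
  classical
  unfold pathSurplus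
  have := Finset.card_le_univ (Finset.univ.filter fun k : Fin N =>
      (o k).isInsertion = true ∧ StrictlyBeneath γ (dot g o k))
  rw [Fintype.card_fin] at this
  have h2 : (0 : ℤ) ≤ ((Finset.univ.filter fun k : Fin N =>
      (o k).isInsertion = false ∧ StrictlyBeneath γ (dot g o k)).card : ℤ) := by positivity
  omega

/-- The supremum that defines `intervalSurplus` is an attained maximum. -/
theorem intervalSurplus_isGreatest {U : Type*} {n N : ℕ} (g : U → Fin n)
    (o : Fin N → Operation U) (i j : ℕ) (hij : i ≤ j + 1) :
    IsGreatest (Set.range fun γ : MonotonePath ((i : ℝ) - 1, (1 : ℝ)) ((j : ℝ), (N : ℝ) + 1) =>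
      pathSurplus g o γ) (intervalSurplus g o i j) := by
  have hb : BddAbove (Set.range fun γ : MonotonePath ((i : ℝ) - 1, (1 : ℝ))
      ((j : ℝ), (N : ℝ) + 1) => pathSurplus g o γ) := by
    refine ⟨N, ?_⟩
    rintro _ ⟨γ, rfl⟩
    exact pathSurplus_le g o γ
  have hne : Nonempty (MonotonePath ((i : ℝ) - 1, (1 : ℝ)) ((j : ℝ), (N : ℝ) + 1)) := by
    apply monotonePath_nonempty
    have : (i : ℝ) ≤ j + 1 := by exact_mod_cast hij
    exact ⟨by simpa using this, by simp⟩
  exact ⟨Int.csSup_mem (Set.range_nonempty _) hb, fun x hx => le_csSup hb hx⟩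

/-! Group the operations into consecutive pairs, each holding one blue and one red dot. Since the
keys are distinct, the columns of the dots are independent and uniform, so everything reduces to
averages over `Fin R → Fin n × Fin n`. Coarsen about `t` columns into `4 ^ L` blocks and the `R`
pairs of rows into `B * 4 ^ L` bands of `ρ` pairs, with `L = 2 * B ^ 2`. A staircase on this grid is
a legal monotonic path, so it suffices to find a good one.

Start from the line of slope `B` across the grid. At every scale cut each line of slope `d` into
quarters and either keep it or lift its middle half, using slopes `d + 1, d, d, d - 1`. Later bumps
on a piece of width `w` raise it by less than `w / 4 + w / 16 + ⋯ = w / 3`. Hence a region of area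
at least `w ^ 2`, where `w` is the width of a quarter, lies above every refinement of the straight
line and below every refinement of the bumped one. Swapping the two colours inside this region
preserves the measure, does not change the value of the straight option and shifts that of the
bumped option by minus twice the surplus `X` of the region. The better option therefore gains `E|X|
/ 2` over the average of the two, although the choices at smaller scales depend on the same dots
(`StripRegion.expect_max_ge`). A fourth-moment bound makes `E|X|` of the order of the standard
deviation, at least `s * w`, where `s ^ 2` is about the mean number of blue dots in a grid cell.

Thus every scale gains a constant times `s * 4 ^ L`. The price is that slopes must stay nonnegative:
the slope above a given block behaves like a lazy random walk, which stays inside `[0, 2 * B]` for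
about `B ^ 2` steps. The potential `r * (1 - (d - B) ^ 2 / B ^ 2)` expresses this in
`expect_bumpValue_ge`. Since `s` is about `m / (√B * 4 ^ L)`, the total is about `m * B ^ 2 / √B = m
* B ^ (3 / 2)`, and `B` may be taken of order `√(log m)`, which produces the exponent `3 / 4`. -/

/-! ### Moments of sums of independent variables -/

section Moments

variable {A : Type*} [Fintype A]

theorem expect_fin_succ {R : ℕ} (F : (Fin (R + 1) → A) → ℝ) :
    Finset.univ.expect F =
      Finset.univ.expect fun p : A => Finset.univ.expect fun ω : Fin R → A =>
        F (Fin.cons p ω) := by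
  rw [← Finset.expect_product' (s := Finset.univ) (t := Finset.univ)
    (f := fun (p : A) (ω : Fin R → A) => F (Fin.cons p ω)), Finset.univ_product_univ]
  exact (Fintype.expect_equiv (Fin.consEquiv fun _ : Fin (R + 1) => A)
    (fun x : A × (Fin R → A) => F (Fin.cons x.1 x.2)) F (fun x => rfl)).symm

variable [Nonempty A]

/-- Induction on the number of variables: expanding the power of (new variable + old sum), each term
linear in one of the two averages to zero, and the fourth moment of the new variable is at most its
second. -/
theorem moments_sum {R : ℕ} (ξ : Fin R → A → ℝ) (h0 : ∀ k, Finset.univ.expect (ξ k) = 0)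
    (h1 : ∀ k p, |ξ k p| ≤ 1) :
    (Finset.univ.expect fun ω : Fin R → A => ∑ k, ξ k (ω k)) = 0 ∧
    (Finset.univ.expect fun ω : Fin R → A => (∑ k, ξ k (ω k)) ^ 2) =
      (∑ k, Finset.univ.expect fun p => ξ k p ^ 2) ∧
    (Finset.univ.expect fun ω : Fin R → A => (∑ k, ξ k (ω k)) ^ 4) ≤
      3 * (∑ k, Finset.univ.expect fun p => ξ k p ^ 2) ^ 2 +
        ∑ k, Finset.univ.expect fun p => ξ k p ^ 2 := by
  induction R with
  | zero => simp
  | succ R ih =>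
    obtain ⟨i1, i2, i4⟩ := ih (fun k => ξ k.succ) (fun k => h0 _) (fun k => h1 _)
    set V := ∑ k : Fin R, Finset.univ.expect fun p => ξ k.succ p ^ 2 with hV
    set X : (Fin R → A) → ℝ := fun ω => ∑ k, ξ k.succ (ω k) with hX
    set q := Finset.univ.expect fun p => ξ 0 p ^ 2 with hq
    have hq0 : 0 ≤ q := Finset.expect_nonneg fun p _ => sq_nonneg _
    have hV0 : 0 ≤ V := Finset.sum_nonneg fun k _ => Finset.expect_nonneg fun p _ => sq_nonneg _
    have hq4 : (Finset.univ.expect fun p => ξ 0 p ^ 4) ≤ q := by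
      refine Finset.expect_le_expect fun p _ => ?_
      have := (sq_le_one_iff_abs_le_one _).2 (h1 0 p)
      nlinarith [sq_nonneg (ξ 0 p)]
    simp only [expect_fin_succ, Fin.sum_univ_succ, Fin.cons_zero, Fin.cons_succ, ← hV]
    have e0 := h0 0
    refine ⟨?_, ?_, ?_⟩
    · simp only [Finset.expect_add_distrib, Finset.expect_const Finset.univ_nonempty]
      rw [e0]; change 0 + Finset.univ.expect X = 0
      rw [i1, add_zero]
    · have : ∀ p, (Finset.univ.expect fun ω => (ξ 0 p + X ω) ^ 2) = ξ 0 p ^ 2 + V := by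
        intro p
        have : (fun ω => (ξ 0 p + X ω) ^ 2) =
            fun ω => ξ 0 p ^ 2 + (2 * ξ 0 p) * X ω + X ω ^ 2 := by
          funext ω; ring
        rw [this, Finset.expect_add_distrib, Finset.expect_add_distrib,
          Finset.expect_const Finset.univ_nonempty, ← Finset.mul_expect, i1, i2]
        ring
      change (Finset.univ.expect fun p => Finset.univ.expect fun ω => (ξ 0 p + X ω) ^ 2) = _
      simp only [this, Finset.expect_add_distrib, Finset.expect_const Finset.univ_nonempty]
    · set T := Finset.univ.expect fun ω => X ω ^ 3
      have : ∀ p, (Finset.univ.expect fun ω => (ξ 0 p + X ω) ^ 4) =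
          ξ 0 p ^ 4 + (6 * V) * ξ 0 p ^ 2 + (4 * T) * ξ 0 p +
            Finset.univ.expect fun ω => X ω ^ 4 := by
        intro p
        have : (fun ω => (ξ 0 p + X ω) ^ 4) =
            fun ω => ξ 0 p ^ 4 + (4 * ξ 0 p ^ 3) * X ω + (6 * ξ 0 p ^ 2) * X ω ^ 2 +
              (4 * ξ 0 p) * X ω ^ 3 + X ω ^ 4 := by
          funext ω; ring
        rw [this, Finset.expect_add_distrib, Finset.expect_add_distrib,
          Finset.expect_add_distrib, Finset.expect_add_distrib,
          Finset.expect_const Finset.univ_nonempty, ← Finset.mul_expect, ← Finset.mul_expect,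
          ← Finset.mul_expect, i1, i2]
        ring
      change (Finset.univ.expect fun p => Finset.univ.expect fun ω => (ξ 0 p + X ω) ^ 4) ≤ _
      simp only [this, Finset.expect_add_distrib, Finset.expect_const Finset.univ_nonempty,
        ← Finset.mul_expect]
      rw [e0, ← hq]
      change _ ≤ 3 * V ^ 2 + V at i4
      change _ + _ + _ + Finset.univ.expect (fun ω => X ω ^ 4) ≤ _
      nlinarith [sq_nonneg q]

/-- A Khintchine-type inequality for sums of independent bounded centred variables. -/
theorem expect_abs_sum_ge {R : ℕ} (ξ : Fin R → A → ℝ) (h0 : ∀ k, Finset.univ.expect (ξ k) = 0)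
    (h1 : ∀ k p, |ξ k p| ≤ 1) (hV : 1 ≤ ∑ k, Finset.univ.expect fun p => ξ k p ^ 2) :
    3 / 8 * √(∑ k, Finset.univ.expect fun p => ξ k p ^ 2) ≤
      Finset.univ.expect fun ω : Fin R → A => |∑ k, ξ k (ω k)| := by
  obtain ⟨-, i2, i4⟩ := moments_sum ξ h0 h1
  set V := ∑ k, Finset.univ.expect fun p => ξ k p ^ 2
  set s := √V with hs
  have hss : s ^ 2 = V := Real.sq_sqrt (by linarith)
  have hs0 : 0 < s := Real.sqrt_pos.2 (by linarith)
  -- A minorant of `|x|` by even powers, so that only the second and fourth moments enter. With `|x|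
  -- = 2 * s * u` it reads `u ^ 2 - u ^ 4 / 4 ≤ u`; on average it gives `s / 2 - s / 8 = 3 / 8 * s`.
  have key : ∀ x : ℝ, 1 / (2 * s) * x ^ 2 - 1 / (32 * s ^ 3) * x ^ 4 ≤ |x| := by
    intro x
    have hu : ∃ u : ℝ, 0 ≤ u ∧ |x| = 2 * s * u := ⟨|x| / (2 * s), by positivity, by field_simp⟩
    obtain ⟨u, hu0, hu⟩ := hu
    have h2 : x ^ 2 = (2 * s * u) ^ 2 := by rw [← hu, sq_abs]
    have h4 : x ^ 4 = (2 * s * u) ^ 4 := by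
      calc x ^ 4 = (x ^ 2) ^ 2 := by ring
        _ = _ := by rw [h2]; ring
    rw [h2, h4, hu]
    have : 1 / (2 * s) * (2 * s * u) ^ 2 - 1 / (32 * s ^ 3) * (2 * s * u) ^ 4 =
        2 * s * (u ^ 2 - u ^ 4 / 4) := by field_simp; ring
    rw [this]
    have : u ^ 2 - u ^ 4 / 4 ≤ u := by
      have : 0 ≤ u * ((u - 6 / 5) ^ 2 * (u + 12 / 5) + 8 / 25 * u + 68 / 125) := by positivity
      nlinarith
    gcongr
  have := Finset.expect_le_expect (s := Finset.univ)
    (fun (ω : Fin R → A) _ => key (∑ k, ξ k (ω k)))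
  refine le_trans ?_ this
  rw [Finset.expect_sub_distrib, ← Finset.mul_expect, ← Finset.mul_expect, i2]
  have h4 : 1 / (32 * s ^ 3) * (Finset.univ.expect fun ω : Fin R → A => (∑ k, ξ k (ω k)) ^ 4) ≤
      1 / (32 * s ^ 3) * (4 * V ^ 2) := by
    gcongr
    nlinarith
  have : 1 / (2 * s) * V - 1 / (32 * s ^ 3) * (4 * V ^ 2) = 3 / 8 * s := by
    rw [← hss]; field_simp; ring
  linarith

end Moments

/-! ### Paths with bumps at all scales -/

section MultiscalePath

/-- The value of the best path obtained by adding bumps, at all scales, to the line of slope `d`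
that starts over `x₀` at height `h₀` and spans `4 ^ r` columns; `W x h` is the weight of the
column `x` below height `h`. -/
noncomputable def bumpValue (W : ℕ → ℕ → ℝ) : ℕ → ℕ → ℕ → ℕ → ℝ
  | 0, x₀, h₀, _ => W x₀ h₀
  | r + 1, x₀, h₀, d =>
    max (bumpValue W r x₀ h₀ d + bumpValue W r (x₀ + 4 ^ r) (h₀ + d * 4 ^ r) d +
        bumpValue W r (x₀ + 2 * 4 ^ r) (h₀ + 2 * d * 4 ^ r) d +
        bumpValue W r (x₀ + 3 * 4 ^ r) (h₀ + 3 * d * 4 ^ r) d)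
      (if d = 0 then
        bumpValue W r x₀ h₀ d + bumpValue W r (x₀ + 4 ^ r) (h₀ + d * 4 ^ r) d +
        bumpValue W r (x₀ + 2 * 4 ^ r) (h₀ + 2 * d * 4 ^ r) d +
        bumpValue W r (x₀ + 3 * 4 ^ r) (h₀ + 3 * d * 4 ^ r) d
      else
        bumpValue W r x₀ h₀ (d + 1) + bumpValue W r (x₀ + 4 ^ r) (h₀ + (d + 1) * 4 ^ r) d +
        bumpValue W r (x₀ + 2 * 4 ^ r) (h₀ + (2 * d + 1) * 4 ^ r) d +
        bumpValue W r (x₀ + 3 * 4 ^ r) (h₀ + (3 * d + 1) * 4 ^ r) (d - 1))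

theorem sum_range_four_mul (f : ℕ → ℝ) (w : ℕ) :
    ∑ i ∈ Finset.range (4 * w), f i = ∑ i ∈ Finset.range w, f i +
      ∑ i ∈ Finset.range w, f (w + i) + ∑ i ∈ Finset.range w, f (2 * w + i) +
      ∑ i ∈ Finset.range w, f (3 * w + i) := by
  rw [show 4 * w = w + w + w + w by ring, Finset.sum_range_add, Finset.sum_range_add,
    Finset.sum_range_add, show w + w + w = 3 * w by ring, show w + w = 2 * w by ring]

/-- Every path competing in `bumpValue` stays on or above its line and rises less than `4 ^ r / 3`
over it. A change of weight that is constant in height within this sliver affects all competitors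
equally and commutes with every maximum. -/
theorem bumpValue_shift {W W' : ℕ → ℕ → ℝ} {f : ℕ → ℝ} (r x₀ h₀ d : ℕ)
    (h : ∀ i e, i < 4 ^ r → 3 * e < 4 ^ r →
      W' (x₀ + i) (h₀ + d * i + e) = W (x₀ + i) (h₀ + d * i + e) + f (x₀ + i)) :
    bumpValue W' r x₀ h₀ d = bumpValue W r x₀ h₀ d + ∑ i ∈ Finset.range (4 ^ r), f (x₀ + i) := by
  induction r generalizing x₀ h₀ d with
  | zero => simpa [bumpValue] using h 0 0
  | succ r ih =>
    rw [pow_succ, mul_comm] at h ⊢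
    rw [sum_range_four_mul]
    set w := 4 ^ r with hw
    have key : ∀ j z d', (∀ i e, i < w → 3 * e < w →
        ∃ i' e', i' < 4 * w ∧ 3 * e' < 4 * w ∧ x₀ + j + i = x₀ + i' ∧
          z + d' * i + e = h₀ + d * i' + e') →
        bumpValue W' r (x₀ + j) z d' = bumpValue W r (x₀ + j) z d' +
          ∑ i ∈ Finset.range w, f (x₀ + (j + i)) := by
      intro j z d' hj
      rw [ih]
      · simp only [add_assoc, hw]
      · intro i e hi he
        obtain ⟨i', e', h1, h2, h3, h4⟩ := hj i e hi he
        rw [h3, h4, h i' e' h1 h2]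
    have k1 := key 0 h₀ d fun i e hi he => ⟨i, e, by omega, by omega, by ring, by ring⟩
    have k2 := key w (h₀ + d * w) d fun i e hi he =>
      ⟨w + i, e, by omega, by omega, by ring, by ring⟩
    have k3 := key (2 * w) (h₀ + 2 * d * w) d fun i e hi he =>
      ⟨2 * w + i, e, by omega, by omega, by ring, by ring⟩
    have k4 := key (3 * w) (h₀ + 3 * d * w) d fun i e hi he =>
      ⟨3 * w + i, e, by omega, by omega, by ring, by ring⟩
    have l1 := key 0 h₀ (d + 1) fun i e hi he =>
      ⟨i, i + e, by omega, by omega, by ring, by ring⟩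
    have l2 := key w (h₀ + (d + 1) * w) d fun i e hi he =>
      ⟨w + i, w + e, by omega, by omega, by ring, by ring⟩
    have l3 := key (2 * w) (h₀ + (2 * d + 1) * w) d fun i e hi he =>
      ⟨2 * w + i, w + e, by omega, by omega, by ring, by ring⟩
    -- The last quarter descends back to the line: at offset `i` it is still `w - i` above it.
    have l4 : d ≠ 0 → _ := fun hd => key (3 * w) (h₀ + (3 * d + 1) * w) (d - 1) fun i e hi he => by
      obtain ⟨j, hj⟩ := Nat.exists_eq_add_of_le hi.le
      obtain ⟨d', rfl⟩ := Nat.exists_eq_succ_of_ne_zero hd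
      refine ⟨3 * w + i, j + e, by omega, by omega, by ring, ?_⟩
      simp only [Nat.succ_eq_add_one, Nat.add_sub_cancel]
      rw [hj]; ring
    simp only [bumpValue, ← hw]
    simp only [add_zero, zero_add] at k1 l1
    by_cases hd : d = 0
    · simp only [hd, if_true, max_self] at *
      rw [k1, k2, k3, k4]; ring
    · simp only [hd, if_false]
      rw [k1, k2, k3, k4, l1, l2, l3, l4 hd, ← max_add_add_right]
      congr 1 <;> ring

/-- The shared barriers `b 1`, `b 2`, `b 3` make the glued function monotone across the joints. -/
theorem exists_concat_path (W : ℕ → ℕ → ℝ) (x₀ w : ℕ) (b : ℕ → ℕ) (v : ℕ → ℝ)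
    (h : ∀ j < 4, ∃ H : ℕ → ℕ, (∀ x y, x₀ + j * w ≤ x → x ≤ y → y < x₀ + j * w + w → H x ≤ H y) ∧
      (∀ x, x₀ + j * w ≤ x → x < x₀ + j * w + w → b j ≤ H x ∧ H x ≤ b (j + 1)) ∧
      v j = ∑ i ∈ Finset.range w, W (x₀ + j * w + i) (H (x₀ + j * w + i))) :
    ∃ H : ℕ → ℕ, (∀ x y, x₀ ≤ x → x ≤ y → y < x₀ + 4 * w → H x ≤ H y) ∧
      (∀ x, x₀ ≤ x → x < x₀ + 4 * w → b 0 ≤ H x ∧ H x ≤ b 4) ∧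
      v 0 + v 1 + v 2 + v 3 = ∑ i ∈ Finset.range (4 * w), W (x₀ + i) (H (x₀ + i)) := by
  obtain ⟨H0, m0, r0, s0⟩ := h 0 (by norm_num)
  obtain ⟨H1, m1, r1, s1⟩ := h 1 (by norm_num)
  obtain ⟨H2, m2, r2, s2⟩ := h 2 (by norm_num)
  obtain ⟨H3, m3, r3, s3⟩ := h 3 (by norm_num)
  simp only [zero_mul, add_zero, one_mul, zero_add, Nat.reduceAdd] at *
  set H : ℕ → ℕ := fun x => if x < x₀ + w then H0 x else if x < x₀ + 2 * w then H1 x else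
    if x < x₀ + 3 * w then H2 x else H3 x with hH
  rcases Nat.eq_zero_or_pos w with rfl | hw
  · refine ⟨fun _ => b 0, ?_, ?_, ?_⟩
    · intros; rfl
    · intro x h1 h2; omega
    · simp [s0, s1, s2, s3]
  have b01 := (r0 x₀ (by omega) (by omega))
  have b12 := (r1 (x₀ + w) (by omega) (by omega))
  have b23 := (r2 (x₀ + 2 * w) (by omega) (by omega))
  have b34 := (r3 (x₀ + 3 * w) (by omega) (by omega))
  have R0 : ∀ x, x₀ ≤ x → x < x₀ + w → H x = H0 x := fun x a1 a2 => by simp [hH, a2]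
  have R1 : ∀ x, x₀ + w ≤ x → x < x₀ + 2 * w → H x = H1 x := fun x a1 a2 => by
    simp [hH, a2, not_lt.2 a1]
  have R2 : ∀ x, x₀ + 2 * w ≤ x → x < x₀ + 3 * w → H x = H2 x := fun x a1 a2 => by
    simp [hH, a2, not_lt.2 a1, not_lt.2 (show x₀ + w ≤ x by omega)]
  have R3 : ∀ x, x₀ + 3 * w ≤ x → x < x₀ + 4 * w → H x = H3 x := fun x a1 a2 => by
    simp [hH, not_lt.2 a1, not_lt.2 (show x₀ + w ≤ x by omega),
      not_lt.2 (show x₀ + 2 * w ≤ x by omega)]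
  have cases4 : ∀ x, x₀ ≤ x → x < x₀ + 4 * w →
      (x < x₀ + w ∧ H x = H0 x ∧ b 0 ≤ H x ∧ H x ≤ b 1) ∨
      (x₀ + w ≤ x ∧ x < x₀ + 2 * w ∧ H x = H1 x ∧ b 1 ≤ H x ∧ H x ≤ b 2) ∨
      (x₀ + 2 * w ≤ x ∧ x < x₀ + 3 * w ∧ H x = H2 x ∧ b 2 ≤ H x ∧ H x ≤ b 3) ∨
      (x₀ + 3 * w ≤ x ∧ H x = H3 x ∧ b 3 ≤ H x ∧ H x ≤ b 4) := by
    intro x a1 a2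
    rcases lt_or_ge x (x₀ + w) with c1 | c1
    · have e := R0 x a1 c1
      have := r0 x a1 c1
      exact Or.inl ⟨c1, e, by omega, by omega⟩
    rcases lt_or_ge x (x₀ + 2 * w) with c2 | c2
    · have e := R1 x c1 c2
      have := r1 x c1 (by omega)
      exact Or.inr (Or.inl ⟨c1, c2, e, by omega, by omega⟩)
    rcases lt_or_ge x (x₀ + 3 * w) with c3 | c3
    · have e := R2 x c2 c3
      have := r2 x c2 (by omega)
      exact Or.inr (Or.inr (Or.inl ⟨c2, c3, e, by omega, by omega⟩))
    · have e := R3 x c3 a2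
      have := r3 x c3 (by omega)
      exact Or.inr (Or.inr (Or.inr ⟨c3, e, by omega, by omega⟩))
  refine ⟨H, ?_, ?_, ?_⟩
  · intro x y hx hxy hy
    have n0 := m0 x y
    have n1 := m1 x y
    have n2 := m2 x y
    have n3 := m3 x y
    have cx := cases4 x hx (by omega)
    have cy := cases4 y (by omega) hy
    omega
  · intro x hx hx4
    have cx := cases4 x hx hx4
    omega
  · rw [sum_range_four_mul, s0, s1, s2, s3]
    congr 1; congr 1; congr 1
    all_goals
      refine Finset.sum_congr rfl fun i hi => ?_
      have hi := Finset.mem_range.1 hi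
      try simp only [← add_assoc]
    · rw [R0 _ (by omega) (by omega)]
    · rw [R1 _ (by omega) (by omega)]
    · rw [R2 _ (by omega) (by omega)]
    · rw [R3 _ (by omega) (by omega)]

theorem bumpValue_attained (W : ℕ → ℕ → ℝ) (r x₀ h₀ d : ℕ) :
    ∃ H : ℕ → ℕ, (∀ x y, x₀ ≤ x → x ≤ y → y < x₀ + 4 ^ r → H x ≤ H y) ∧
      (∀ x, x₀ ≤ x → x < x₀ + 4 ^ r → h₀ ≤ H x ∧ H x ≤ h₀ + d * 4 ^ r) ∧
      bumpValue W r x₀ h₀ d = ∑ i ∈ Finset.range (4 ^ r), W (x₀ + i) (H (x₀ + i)) := by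
  induction r generalizing x₀ h₀ d with
  | zero =>
    refine ⟨fun _ => h₀, fun _ _ _ _ _ => le_rfl, fun _ _ _ => by simp, by simp [bumpValue]⟩
  | succ r ih =>
    set w := 4 ^ r with hw
    have hw4 : 4 ^ (r + 1) = 4 * w := by rw [hw]; ring
    have hA := exists_concat_path W x₀ w (fun j => h₀ + j * d * w)
      (fun j => bumpValue W r (x₀ + j * w) (h₀ + j * d * w) d) fun j _ => by
        obtain ⟨H, m, b, s⟩ := ih (x₀ + j * w) (h₀ + j * d * w) d
        refine ⟨H, m, fun x h1 h2 => ?_, s⟩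
        have := b x h1 h2
        refine ⟨this.1, this.2.trans (le_of_eq ?_)⟩
        ring
    simp only [zero_mul, add_zero, one_mul] at hA
    simp only [bumpValue, hw4, ← hw]
    by_cases hd : d = 0
    · simp only [hd, if_true, max_self] at *
      simpa using hA
    simp only [hd, if_false]
    rcases max_choice (bumpValue W r x₀ h₀ d + bumpValue W r (x₀ + w) (h₀ + d * w) d +
        bumpValue W r (x₀ + 2 * w) (h₀ + 2 * d * w) d +
        bumpValue W r (x₀ + 3 * w) (h₀ + 3 * d * w) d)
        (bumpValue W r x₀ h₀ (d + 1) + bumpValue W r (x₀ + w) (h₀ + (d + 1) * w) d +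
        bumpValue W r (x₀ + 2 * w) (h₀ + (2 * d + 1) * w) d +
        bumpValue W r (x₀ + 3 * w) (h₀ + (3 * d + 1) * w) (d - 1)) with hm | hm
    · rw [hm]
      obtain ⟨H, a1, a2, a3⟩ := hA
      refine ⟨H, a1, fun x h1 h2 => ?_, a3⟩
      have := a2 x h1 h2
      refine ⟨this.1, this.2.trans (le_of_eq (by ring))⟩
    · rw [hm]
      have hB := exists_concat_path W x₀ w
        (fun j => h₀ + j * d * w + if 1 ≤ j ∧ j < 4 then w else 0)
        (fun j => bumpValue W r (x₀ + j * w) (h₀ + j * d * w + if 1 ≤ j ∧ j < 4 then w else 0)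
          (if j = 0 then d + 1 else if j = 3 then d - 1 else d)) fun j hj => by
          obtain ⟨H, m, b, s⟩ := ih (x₀ + j * w)
            (h₀ + j * d * w + if 1 ≤ j ∧ j < 4 then w else 0)
            (if j = 0 then d + 1 else if j = 3 then d - 1 else d)
          refine ⟨H, m, fun x h1 h2 => ?_, s⟩
          have := b x h1 h2
          refine ⟨this.1, this.2.trans (le_of_eq ?_)⟩
          obtain ⟨d', rfl⟩ := Nat.exists_eq_succ_of_ne_zero hd
          interval_cases j <;> simp <;> ring
      norm_num at hB
      obtain ⟨H, a1, a2, a3⟩ := hB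
      refine ⟨H, a1, fun x h1 h2 => ?_, ?_⟩
      · have := a2 x h1 h2
        refine ⟨this.1, this.2.trans (le_of_eq (by ring))⟩
      · rw [← a3, show h₀ + (d + 1) * w = h₀ + d * w + w by ring,
          show h₀ + (2 * d + 1) * w = h₀ + 2 * d * w + w by ring,
          show h₀ + (3 * d + 1) * w = h₀ + 3 * d * w + w by ring]

end MultiscalePath

/-! ### Colour swaps in a region of a strip -/

section Flip

variable {n R : ℕ}

/-- The contribution to the block `x` of a blue dot in column `p.1` and a red dot in `p.2`. -/
noncomputable def blockWeight (β : Fin n → ℕ) (x : ℕ) (p : Fin n × Fin n) : ℝ :=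
  (if β p.1 = x then 1 else 0) - (if β p.2 = x then 1 else 0)

/-- The surplus of the dots of block `x` in the first `ρ * h` pairs of rows. -/
noncomputable def prefixWeight (β : Fin n → ℕ) (ρ : ℕ) (ω : Fin R → Fin n × Fin n) (x h : ℕ) : ℝ :=
  ∑ k : Fin R, if (k : ℕ) < ρ * h then blockWeight β x (ω k) else 0

/-- A region of the strip made of the blocks in `I`: in the block `x`, the pairs of rows
`lo x, …, hi x - 1`. -/
structure StripRegion where
  I : Finset ℕ
  lo : ℕ → ℕ
  hi : ℕ → ℕ

namespace StripRegion

variable (D : StripRegion) (β : Fin n → ℕ)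

/-- The blue dot is in the region and the red dot is outside the strip. -/
def Isolated (k : ℕ) (p : Fin n × Fin n) : Prop :=
  (β p.1 ∈ D.I ∧ D.lo (β p.1) ≤ k ∧ k < D.hi (β p.1)) ∧ β p.2 ∉ D.I

instance (k : ℕ) (p : Fin n × Fin n) : Decidable (D.Isolated β k p) := by
  unfold Isolated; infer_instance

/-- The part of the surplus of block `x` that `flip` negates. Requiring the partner dot to lie
outside the strip ensures that a swap changes nothing else in the strip. -/
noncomputable def columnWeight (k x : ℕ) (p : Fin n × Fin n) : ℝ :=
  (if D.Isolated β k p ∧ β p.1 = x then 1 else 0) -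
    (if D.Isolated β k p.swap ∧ β p.2 = x then 1 else 0)

noncomputable def weight (k : ℕ) (p : Fin n × Fin n) : ℝ :=
  (if D.Isolated β k p then 1 else 0) - (if D.Isolated β k p.swap then 1 else 0)

/-- Swap the dots of the pairs of rows that have exactly one dot in the strip, lying in `D`. -/
def flip (ω : Fin R → Fin n × Fin n) (k : Fin R) : Fin n × Fin n :=
  if D.Isolated β k (ω k) ∨ D.Isolated β k (ω k).swap then (ω k).swap else ω k

theorem flip_involutive : Function.Involutive (D.flip β (R := R)) := by
  intro ω
  funext k
  by_cases h : D.Isolated β k (ω k) ∨ D.Isolated β k (ω k).swap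
  · have : D.flip β ω k = (ω k).swap := by simp [flip, h]
    rw [flip, this, Prod.swap_swap, if_pos h.symm]
  · have : D.flip β ω k = ω k := by simp [flip, h]
    rw [flip, this, if_neg h]

theorem expect_flip (F : (Fin R → Fin n × Fin n) → ℝ) :
    (Finset.univ.expect fun ω => F (D.flip β ω)) = Finset.univ.expect F :=
  Fintype.expect_equiv (D.flip_involutive β).toPerm _ _ fun _ => rfl

theorem blockWeight_flip {x : ℕ} (hx : x ∈ D.I) (ω : Fin R → Fin n × Fin n) (k : Fin R) :
    blockWeight β x (D.flip β ω k) = blockWeight β x (ω k) - 2 * D.columnWeight β k x (ω k) := by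
  unfold flip columnWeight
  by_cases h1 : D.Isolated β k (ω k)
  · have h2 : ¬ D.Isolated β k (ω k).swap := fun h2 => h1.2 h2.1.1
    have h3 : β (ω k).2 ≠ x := fun h => h1.2 (h ▸ hx)
    simp only [h1, h2, true_or, if_true, true_and, false_and, if_false, blockWeight, Prod.fst_swap,
      Prod.snd_swap, h3]
    split_ifs <;> norm_num
  · by_cases h2 : D.Isolated β k (ω k).swap
    · have h3 : β (ω k).1 ≠ x := fun h => h2.2 (by simpa [h] using hx)
      simp only [h1, h2, or_true, if_true, true_and, false_and, if_false, blockWeight,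
        Prod.fst_swap, Prod.snd_swap, h3]
      split_ifs <;> norm_num
    · simp [h1, h2]

theorem sum_columnWeight (k : ℕ) (p : Fin n × Fin n) :
    ∑ x ∈ D.I, D.columnWeight β k x p = D.weight β k p := by
  unfold columnWeight weight
  rw [Finset.sum_sub_distrib]
  congr 1
  · by_cases h : D.Isolated β k p
    · simp [h, h.1.1]
    · simp [h]
  · by_cases h : D.Isolated β k p.swap
    · have := h.1.1
      rw [Prod.fst_swap] at this
      simp [h, this]
    · simp [h]

theorem columnWeight_eq_zero {k x : ℕ} (h : ¬ (D.lo x ≤ k ∧ k < D.hi x)) (p : Fin n × Fin n) :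
    D.columnWeight β k x p = 0 := by
  unfold columnWeight
  rw [if_neg, if_neg, sub_zero]
  · rintro ⟨h1, rfl⟩; exact h h1.1.2
  · rintro ⟨h1, rfl⟩; exact h h1.1.2

theorem prefixWeight_flip_of_disjoint {ρ x h : ℕ} (hx : x ∈ D.I)
    (hD : ∀ k, D.lo x ≤ k → k < D.hi x → ρ * h ≤ k) (ω : Fin R → Fin n × Fin n) :
    prefixWeight β ρ (D.flip β ω) x h = prefixWeight β ρ ω x h := by
  refine Finset.sum_congr rfl fun k _ => ?_
  split_ifs with hk
  · rw [D.blockWeight_flip β hx, D.columnWeight_eq_zero β, mul_zero, sub_zero]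
    rintro ⟨h1, h2⟩
    exact absurd (hD k h1 h2) (by omega)
  · rfl

theorem prefixWeight_flip_of_subset {ρ x h : ℕ} (hx : x ∈ D.I)
    (hD : ∀ k, D.lo x ≤ k → k < D.hi x → k < ρ * h) (ω : Fin R → Fin n × Fin n) :
    prefixWeight β ρ (D.flip β ω) x h =
      prefixWeight β ρ ω x h + -2 * ∑ k : Fin R, D.columnWeight β k x (ω k) := by
  unfold prefixWeight
  rw [Finset.mul_sum, ← Finset.sum_add_distrib]
  refine Finset.sum_congr rfl fun k _ => ?_
  split_ifs with hk
  · rw [D.blockWeight_flip β hx]; ring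
  · rw [D.columnWeight_eq_zero β, mul_zero, add_zero]
    rintro ⟨h1, h2⟩
    exact hk (hD k h1 h2)

theorem abs_weight_le (k : ℕ) (p : Fin n × Fin n) : |D.weight β k p| ≤ 1 := by
  unfold weight
  split_ifs <;> simp

theorem weight_swap (k : ℕ) (p : Fin n × Fin n) : D.weight β k p.swap = -D.weight β k p := by
  unfold weight
  rw [Prod.swap_swap]; ring

theorem expect_weight (k : ℕ) : Finset.univ.expect (D.weight β k) = 0 := by
  have h := Fintype.expect_equiv (Equiv.prodComm (Fin n) (Fin n)) (fun p => D.weight β k p.swap)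
    (D.weight β k) (fun p => rfl)
  simp only [weight_swap, Finset.expect_neg_distrib] at h
  linarith

theorem card_preimage {β : Fin n → ℕ} {a : ℕ} (S : Finset ℕ)
    (hβ : ∀ x ∈ S, (Finset.univ.filter fun c => β c = x).card = a) :
    (Finset.univ.filter fun c => β c ∈ S).card = a * S.card := by
  rw [Finset.card_eq_sum_card_fiberwise (f := β) (t := S) (fun c hc => by simpa using hc),
    Finset.sum_congr rfl (g := fun _ => a), Finset.sum_const, smul_eq_mul, mul_comm]
  intro x hx
  rw [← hβ x hx, Finset.filter_filter]
  congr 1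
  ext c
  simp only [Finset.mem_filter, Finset.mem_univ, true_and]
  constructor
  · rintro ⟨-, h⟩; exact h
  · rintro rfl; exact ⟨hx, rfl⟩

/-- The square is the indicator of two disjoint, equally likely events. The strip covers at most
half of the columns, so the partner misses it with probability at least `1 / 2`, which cancels the
factor two. -/
theorem expect_weight_sq {a : ℕ} (hn : 0 < n)
    (hβ : ∀ x ∈ D.I, (Finset.univ.filter fun c => β c = x).card = a)
    (ha : 2 * (a * D.I.card) ≤ n) (k : ℕ) :
    (a : ℝ) / n * (D.I.filter fun x => D.lo x ≤ k ∧ k < D.hi x).card ≤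
      Finset.univ.expect fun p => D.weight β k p ^ 2 := by
  set S := D.I.filter fun x => D.lo x ≤ k ∧ k < D.hi x with hS
  have h1 : (fun p => D.weight β k p ^ 2) =
      fun p => (if D.Isolated β k p then (1 : ℝ) else 0) +
        if D.Isolated β k p.swap then (1 : ℝ) else 0 := by
    funext p
    unfold weight
    by_cases h1 : D.Isolated β k p
    · have h2 : ¬ D.Isolated β k p.swap := fun h2 => h1.2 h2.1.1
      simp [h1, h2]
    · split_ifs <;> simp
  have h2 := Fintype.expect_equiv (Equiv.prodComm (Fin n) (Fin n))
    (fun p => if D.Isolated β k p.swap then (1 : ℝ) else 0)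
    (fun p => if D.Isolated β k p then (1 : ℝ) else 0) (fun p => rfl)
  rw [h1, Finset.expect_add_distrib, h2, Fintype.expect_eq_sum_div_card, Finset.sum_boole]
  have h3 : (Finset.univ.filter fun p => D.Isolated β k p) =
      (Finset.univ.filter fun c => β c ∈ S) ×ˢ (Finset.univ.filter fun c => β c ∉ D.I) := by
    ext p
    simp only [Finset.mem_filter, Finset.mem_univ, true_and, Finset.mem_product, hS]
    rfl
  have h4 : (Finset.univ.filter fun c => β c ∉ D.I).card + a * D.I.card = n := by
    rw [← card_preimage D.I hβ, add_comm, Finset.card_filter_add_card_filter_not]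
    simp
  have h5 : n ≤ 2 * (Finset.univ.filter fun c => β c ∉ D.I).card := by omega
  rw [h3, Finset.card_product, card_preimage S fun x hx => hβ x (Finset.mem_filter.1 hx).1]
  simp only [Fintype.card_prod, Fintype.card_fin]
  have h6 : (n : ℝ) ≤ 2 * (Finset.univ.filter fun c => β c ∉ D.I).card := by exact_mod_cast h5
  have hn' : (0 : ℝ) < n := by exact_mod_cast hn
  push_cast
  rw [← two_mul]
  rw [show (a : ℝ) / n * S.card = (a * S.card * n) / (n * n) by field_simp, ← mul_div_assoc]
  refine div_le_div_of_nonneg_right ?_ (by positivity)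
  have : (0 : ℝ) ≤ a * S.card := by positivity
  nlinarith

theorem sum_expect_weight_sq {a : ℕ} (hn : 0 < n)
    (hβ : ∀ x ∈ D.I, (Finset.univ.filter fun c => β c = x).card = a)
    (ha : 2 * (a * D.I.card) ≤ n) (hR : ∀ x ∈ D.I, D.hi x ≤ R) :
    (a : ℝ) / n * ∑ x ∈ D.I, ((D.hi x - D.lo x : ℕ) : ℝ) ≤
      ∑ k : Fin R, Finset.univ.expect fun p => D.weight β k p ^ 2 := by
  refine le_trans (le_of_eq ?_)
    (Finset.sum_le_sum fun (k : Fin R) _ => D.expect_weight_sq β hn hβ ha k)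
  rw [← Finset.mul_sum]
  congr 1
  simp only [Finset.card_filter]
  push_cast
  rw [Finset.sum_comm]
  refine Finset.sum_congr rfl fun x hx => ?_
  rw [Finset.sum_boole, ← Nat.card_Ico, ← Finset.card_map Fin.valEmbedding]
  congr 2
  ext k
  have := hR x hx
  simp only [Finset.mem_Ico, Finset.mem_map, Finset.mem_filter, Finset.mem_univ, true_and,
    Fin.valEmbedding_apply]
  exact ⟨fun h => ⟨⟨k, by omega⟩, h, rfl⟩, by rintro ⟨y, hy, rfl⟩; exact hy⟩

/-- If flipping the region does not change `F` and changes `G` by minus twice the surplus of the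
region, then choosing between `F` and `G` gains half of the expected discrepancy. -/
theorem expect_max_ge {a : ℕ} {v : ℝ} (hn : 0 < n)
    (hβ : ∀ x ∈ D.I, (Finset.univ.filter fun c => β c = x).card = a)
    (ha : 2 * (a * D.I.card) ≤ n) (hR : ∀ x ∈ D.I, D.hi x ≤ R) (hv : 1 ≤ v)
    (hv' : v ≤ (a : ℝ) / n * ∑ x ∈ D.I, ((D.hi x - D.lo x : ℕ) : ℝ))
    (F G : (Fin R → Fin n × Fin n) → ℝ) (hF : ∀ ω, F (D.flip β ω) = F ω)
    (hG : ∀ ω, G (D.flip β ω) = G ω + -2 * ∑ k : Fin R, D.weight β k (ω k)) :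
    1 / 2 * (Finset.univ.expect F + Finset.univ.expect G + 3 / 8 * √v) ≤
      Finset.univ.expect fun ω => max (F ω) (G ω) := by
  have : NeZero n := ⟨hn.ne'⟩
  have hV := hv'.trans (D.sum_expect_weight_sq β hn hβ ha hR)
  have h0 := (moments_sum (fun k : Fin R => D.weight β k) (fun k => D.expect_weight β k)
    (fun k p => D.abs_weight_le β k p)).1
  have h1 := expect_abs_sum_ge (fun k : Fin R => D.weight β k) (fun k => D.expect_weight β k)
    (fun k p => D.abs_weight_le β k p) (hv.trans hV)
  have h2 := (mul_le_mul_of_nonneg_left (Real.sqrt_le_sqrt hV)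
    (by norm_num : (0 : ℝ) ≤ 3 / 8)).trans h1
  have h3 := D.expect_flip β fun ω => max (F ω) (G ω)
  simp only [hF, hG] at h3
  -- Pointwise bound for the sum of the two maxima, before and after the flip: take `G` in the one
  -- where it is larger and `F` in the other. The flip makes both maxima equal on average.
  have h4 : (Finset.univ.expect fun ω => F ω + G ω - ∑ k : Fin R, D.weight β k (ω k) +
      |∑ k : Fin R, D.weight β k (ω k)|) ≤ Finset.univ.expect fun ω =>
        max (F ω) (G ω) + max (F ω) (G ω + -2 * ∑ k : Fin R, D.weight β k (ω k)) := by
    refine Finset.expect_le_expect fun ω _ => ?_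
    set X := ∑ k : Fin R, D.weight β k (ω k)
    rcases abs_cases X with ⟨hX, -⟩ | ⟨hX, -⟩ <;> rw [hX]
    · linarith [le_max_right (F ω) (G ω), le_max_left (F ω) (G ω + -2 * X)]
    · linarith [le_max_left (F ω) (G ω), le_max_right (F ω) (G ω + -2 * X)]
  rw [Finset.expect_add_distrib, Finset.expect_sub_distrib, Finset.expect_add_distrib,
    Finset.expect_add_distrib, h3, h0] at h4
  linarith

end StripRegion

theorem expect_prefixWeight (hn : 0 < n) (β : Fin n → ℕ) (ρ x h : ℕ) :
    (Finset.univ.expect fun ω : Fin R → Fin n × Fin n => prefixWeight β ρ ω x h) = 0 := by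
  have : NeZero n := ⟨hn.ne'⟩
  refine (moments_sum (fun (k : Fin R) p => if (k : ℕ) < ρ * h then blockWeight β x p else 0)
    (fun k => ?_) (fun k p => ?_)).1
  · split_ifs
    · have h := Fintype.expect_equiv (Equiv.prodComm (Fin n) (Fin n))
        (fun p => blockWeight β x p.swap) (blockWeight β x) (fun p => rfl)
      have hs : ∀ p : Fin n × Fin n, blockWeight β x p.swap = -blockWeight β x p := fun p => by
        simp [blockWeight]
      simp only [hs, Finset.expect_neg_distrib] at h
      exact (by linarith : Finset.univ.expect (blockWeight β x) = 0)
    · simp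
  · split_ifs
    · unfold blockWeight
      split_ifs <;> simp
    · simp

end Flip

/-! ### Gain per scale and growth over all scales -/

section Growth

variable {n R : ℕ}

/-- Between the line of slope `d` and the line with a bump: the region that separates the paths
refining one of them from those refining the other. -/
def bumpRegion (ρ x₀ h₀ d w : ℕ) : StripRegion where
  I := Finset.Ico x₀ (x₀ + 4 * w)
  lo x := if x₀ + w ≤ x ∧ x < x₀ + 3 * w then ρ * (h₀ + d * (x - x₀) + (w - 1) / 3) else 0
  hi x := if x₀ + w ≤ x ∧ x < x₀ + 3 * w then ρ * (h₀ + d * (x - x₀) + w) else 0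

/-- Refinements of a quarter of the line rise at most `(4 ^ r - 1) / 3` over it, which is where the
region begins. -/
theorem bumpValue_flip_straight {β : Fin n → ℕ} {ρ x₀ h₀ d r j z : ℕ} (hj : j + 4 ^ r ≤ 4 * 4 ^ r)
    (hz : z = h₀ + d * j) (ω : Fin R → Fin n × Fin n) :
    bumpValue (prefixWeight β ρ ((bumpRegion ρ x₀ h₀ d (4 ^ r)).flip β ω)) r (x₀ + j) z d =
      bumpValue (prefixWeight β ρ ω) r (x₀ + j) z d := by
  subst hz
  rw [bumpValue_shift (W := prefixWeight β ρ ω) (f := fun _ => 0)]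
  · simp
  intro i e hi he
  rw [add_zero]
  apply StripRegion.prefixWeight_flip_of_disjoint
  · simp only [bumpRegion, Finset.mem_Ico]; omega
  · intro k h1 h2
    simp only [bumpRegion] at h1 h2
    split_ifs at h1 h2 with h
    · refine le_trans ?_ h1
      rw [show x₀ + j + i - x₀ = j + i by omega, mul_add d]
      refine Nat.mul_le_mul_left _ ?_
      omega
    · omega

/-- On the middle half the bumped line runs along the top of the region, so the whole region lies
beneath its refinements; over the outer quarters the region is empty and `hz` is vacuous. -/
theorem bumpValue_flip_bump {β : Fin n → ℕ} {ρ x₀ h₀ d r j z d' : ℕ} (hj : j + 4 ^ r ≤ 4 * 4 ^ r)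
    (hz : ∀ i < 4 ^ r, 4 ^ r ≤ j + i → j + i < 3 * 4 ^ r → h₀ + d * (j + i) + 4 ^ r ≤ z + d' * i)
    (ω : Fin R → Fin n × Fin n) :
    bumpValue (prefixWeight β ρ ((bumpRegion ρ x₀ h₀ d (4 ^ r)).flip β ω)) r (x₀ + j) z d' =
      bumpValue (prefixWeight β ρ ω) r (x₀ + j) z d' + ∑ i ∈ Finset.range (4 ^ r),
        -2 * ∑ k : Fin R, (bumpRegion ρ x₀ h₀ d (4 ^ r)).columnWeight β k (x₀ + (j + i)) (ω k) := by
  simp only [← add_assoc]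
  apply bumpValue_shift (f := fun x =>
    -2 * ∑ k : Fin R, (bumpRegion ρ x₀ h₀ d (4 ^ r)).columnWeight β k x (ω k))
  intro i e hi he
  apply StripRegion.prefixWeight_flip_of_subset
  · simp only [bumpRegion, Finset.mem_Ico]; omega
  · intro k h1 h2
    simp only [bumpRegion] at h1 h2
    split_ifs at h1 h2 with h
    · refine lt_of_lt_of_le h2 ?_
      have := hz i hi (by omega) (by omega)
      rw [show x₀ + j + i - x₀ = j + i by omega]
      refine Nat.mul_le_mul_left _ ?_
      omega
    · omega

theorem bumpValue_succ_eq_max (W : ℕ → ℕ → ℝ) {r x₀ h₀ d : ℕ} (hd : d ≠ 0) :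
    bumpValue W (r + 1) x₀ h₀ d =
      max (bumpValue W r x₀ h₀ d + bumpValue W r (x₀ + 4 ^ r) (h₀ + d * 4 ^ r) d +
        bumpValue W r (x₀ + 2 * 4 ^ r) (h₀ + 2 * d * 4 ^ r) d +
        bumpValue W r (x₀ + 3 * 4 ^ r) (h₀ + 3 * d * 4 ^ r) d)
      (bumpValue W r x₀ h₀ (d + 1) + bumpValue W r (x₀ + 4 ^ r) (h₀ + (d + 1) * 4 ^ r) d +
        bumpValue W r (x₀ + 2 * 4 ^ r) (h₀ + (2 * d + 1) * 4 ^ r) d +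
        bumpValue W r (x₀ + 3 * 4 ^ r) (h₀ + (3 * d + 1) * 4 ^ r) (d - 1)) := by
  rw [bumpValue, if_neg hd]

theorem le_bumpValue_succ (W : ℕ → ℕ → ℝ) (r x₀ h₀ d : ℕ) :
    bumpValue W r x₀ h₀ d + bumpValue W r (x₀ + 4 ^ r) (h₀ + d * 4 ^ r) d +
        bumpValue W r (x₀ + 2 * 4 ^ r) (h₀ + 2 * d * 4 ^ r) d +
        bumpValue W r (x₀ + 3 * 4 ^ r) (h₀ + 3 * d * 4 ^ r) d ≤ bumpValue W (r + 1) x₀ h₀ d := by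
  rw [bumpValue]
  exact le_max_left _ _

theorem sum_bumpRegion_ge (ρ x₀ h₀ d w : ℕ) (hw : 0 < w) :
    (ρ : ℝ) * w ^ 2 ≤ ∑ x ∈ (bumpRegion ρ x₀ h₀ d w).I,
      (((bumpRegion ρ x₀ h₀ d w).hi x - (bumpRegion ρ x₀ h₀ d w).lo x : ℕ) : ℝ) := by
  have hsub : Finset.Ico (x₀ + w) (x₀ + 3 * w) ⊆ (bumpRegion ρ x₀ h₀ d w).I :=
    Finset.Ico_subset_Ico (by omega) (by omega)
  refine le_trans ?_ (Finset.sum_le_sum_of_subset_of_nonneg hsub fun x _ _ => by positivity)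
  have h1 : ∀ x ∈ Finset.Ico (x₀ + w) (x₀ + 3 * w), ((ρ * (w - (w - 1) / 3) : ℕ) : ℝ) =
      (((bumpRegion ρ x₀ h₀ d w).hi x - (bumpRegion ρ x₀ h₀ d w).lo x : ℕ) : ℝ) := by
    intro x hx
    have hx := Finset.mem_Ico.1 hx
    simp only [bumpRegion, hx, and_self, if_true]
    rw [← Nat.mul_sub]
    congr 2
    omega
  rw [← Finset.sum_congr rfl h1, Finset.sum_const, Nat.card_Ico, nsmul_eq_mul]
  have h2 : ρ * w ^ 2 ≤ (x₀ + 3 * w - (x₀ + w)) * (ρ * (w - (w - 1) / 3)) := by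
    rw [show x₀ + 3 * w - (x₀ + w) = 2 * w by omega]
    have : w ≤ 2 * (w - (w - 1) / 3) := by omega
    calc ρ * w ^ 2 = ρ * w * w := by ring
      _ ≤ ρ * w * (2 * (w - (w - 1) / 3)) := Nat.mul_le_mul_left _ this
      _ = _ := by ring
  exact_mod_cast h2

theorem expect_bumpValue_succ_ge {β : Fin n → ℕ} {ρ a P r x₀ h₀ d : ℕ} (hn : 0 < n)
    (hβ : ∀ x < P, (Finset.univ.filter fun c => β c = x).card = a) (ha : 2 * (a * P) ≤ n)
    (hv : 1 ≤ (a : ℝ) * ρ / n) (hx : x₀ + 4 ^ (r + 1) ≤ P)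
    (hR : ρ * (h₀ + d * 4 ^ (r + 1)) ≤ R) (hd : d ≠ 0) :
    1 / 2 * ((Finset.univ.expect fun ω : Fin R → Fin n × Fin n =>
        bumpValue (prefixWeight β ρ ω) r x₀ h₀ d +
        bumpValue (prefixWeight β ρ ω) r (x₀ + 4 ^ r) (h₀ + d * 4 ^ r) d +
        bumpValue (prefixWeight β ρ ω) r (x₀ + 2 * 4 ^ r) (h₀ + 2 * d * 4 ^ r) d +
        bumpValue (prefixWeight β ρ ω) r (x₀ + 3 * 4 ^ r) (h₀ + 3 * d * 4 ^ r) d) +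
      (Finset.univ.expect fun ω : Fin R → Fin n × Fin n =>
        bumpValue (prefixWeight β ρ ω) r x₀ h₀ (d + 1) +
        bumpValue (prefixWeight β ρ ω) r (x₀ + 4 ^ r) (h₀ + (d + 1) * 4 ^ r) d +
        bumpValue (prefixWeight β ρ ω) r (x₀ + 2 * 4 ^ r) (h₀ + (2 * d + 1) * 4 ^ r) d +
        bumpValue (prefixWeight β ρ ω) r (x₀ + 3 * 4 ^ r) (h₀ + (3 * d + 1) * 4 ^ r) (d - 1)) +
      3 / 8 * (√((a : ℝ) * ρ / n) * 4 ^ r)) ≤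
    Finset.univ.expect fun ω : Fin R → Fin n × Fin n =>
      bumpValue (prefixWeight β ρ ω) (r + 1) x₀ h₀ d := by
  simp only [bumpValue_succ_eq_max _ hd]
  set D := bumpRegion ρ x₀ h₀ d (4 ^ r) with hD
  have hw : 0 < 4 ^ r := by positivity
  have hw1 : (1 : ℝ) ≤ 4 ^ r := one_le_pow₀ (by norm_num)
  rw [pow_succ, mul_comm (4 ^ r) 4] at hx hR
  have hI : ∀ x ∈ D.I, x < P := fun x hx' => by
    have := (Finset.mem_Ico.1 hx').2
    omega
  have hcard : D.I.card ≤ P := by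
    have : D.I.card = 4 * 4 ^ r := by simp [hD, bumpRegion]
    omega
  have hsq : √((a : ℝ) * ρ / n) * 4 ^ r = √((a : ℝ) * ρ / n * (4 ^ r) ^ 2) := by
    rw [Real.sqrt_mul (by linarith), Real.sqrt_sq (by positivity)]
  rw [hsq]
  refine D.expect_max_ge β hn (fun x hx => hβ x (hI x hx)) (le_trans (by gcongr) ha) ?_ ?_ ?_ _ _
    ?_ ?_
  · intro x hx'
    simp only [hD, bumpRegion]
    split_ifs with h
    · refine le_trans (Nat.mul_le_mul_left _ ?_) hR
      have h1 : x - x₀ + 1 ≤ 3 * 4 ^ r := by omega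
      have h2 := Nat.mul_le_mul_left d h1
      have h3 : 1 * 4 ^ r ≤ d * 4 ^ r := Nat.mul_le_mul_right _ (by omega)
      nlinarith
    · omega
  · exact one_le_mul_of_one_le_of_one_le hv (one_le_pow₀ hw1)
  · have := sum_bumpRegion_ge ρ x₀ h₀ d (4 ^ r) hw
    rw [← hD] at this
    calc (a : ℝ) * ρ / n * (4 ^ r) ^ 2 = (a : ℝ) / n * (ρ * ((4 ^ r : ℕ) : ℝ) ^ 2) := by
          push_cast; ring
      _ ≤ _ := by gcongr
  · intro ω
    have k1 := bumpValue_flip_straight (R := R) (β := β) (ρ := ρ) (x₀ := x₀) (h₀ := h₀) (d := d)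
      (r := r) (j := 0) (z := h₀) (by omega) (by ring) ω
    rw [add_zero] at k1
    rw [hD, k1, bumpValue_flip_straight (by omega) (by ring),
      bumpValue_flip_straight (by omega) (by ring), bumpValue_flip_straight (by omega) (by ring)]
  · intro ω
    have k1 := bumpValue_flip_bump (R := R) (β := β) (ρ := ρ) (x₀ := x₀) (h₀ := h₀) (d := d)
      (r := r) (j := 0) (z := h₀) (d' := d + 1) (by omega) (fun i h1 h2 => by omega) ω
    simp only [add_zero, zero_add] at k1
    have hsum : -2 * ∑ k : Fin R, D.weight β k (ω k) = ∑ i ∈ Finset.range (4 * 4 ^ r),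
        -2 * ∑ k : Fin R, D.columnWeight β k (x₀ + i) (ω k) := by
      simp only [← D.sum_columnWeight β]
      rw [Finset.sum_comm, Finset.mul_sum, hD]
      simp only [bumpRegion]
      rw [Finset.sum_Ico_eq_sum_range, add_tsub_cancel_left]
    rw [hsum, sum_range_four_mul, hD, k1,
      bumpValue_flip_bump (by omega) (fun i h1 h2 h3 => le_of_eq (by ring)),
      bumpValue_flip_bump (by omega) (fun i h1 h2 h3 => le_of_eq (by ring)),
      bumpValue_flip_bump (by omega) (fun i h1 h2 h3 => by omega)]
    ring

/-- The expected value of the best multiscale path grows linearly in the number of scales. -/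
theorem expect_bumpValue_ge {β : Fin n → ℕ} {ρ a P B : ℕ} (hn : 0 < n)
    (hβ : ∀ x < P, (Finset.univ.filter fun c => β c = x).card = a) (ha : 2 * (a * P) ≤ n)
    (hv : 1 ≤ (a : ℝ) * ρ / n) (hB : 0 < B) (r x₀ h₀ d : ℕ) (hd : d ≤ 2 * B) (hr : r ≤ 2 * B ^ 2)
    (hx : x₀ + 4 ^ r ≤ P) (hR : ρ * (h₀ + d * 4 ^ r) ≤ R) :
    √((a : ℝ) * ρ / n) / 32 * 4 ^ r * (r * (1 - ((d : ℝ) - B) ^ 2 / B ^ 2)) ≤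
      Finset.univ.expect fun ω : Fin R → Fin n × Fin n =>
        bumpValue (prefixWeight β ρ ω) r x₀ h₀ d := by
  have hB' : (0 : ℝ) < B := by exact_mod_cast hB
  induction r generalizing x₀ h₀ d with
  | zero => simp [bumpValue, expect_prefixWeight hn]
  | succ r ih =>
    have e4 : 4 ^ (r + 1) = 4 * 4 ^ r := by ring
    have hx' := hx
    have hR' := hR
    rw [e4] at hx hR
    set s := √((a : ℝ) * ρ / n) with hs
    have ih' : ∀ j z d', j ≤ 3 → d' ≤ 2 * B → z + d' * 4 ^ r ≤ h₀ + d * (4 * 4 ^ r) →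
        s / 32 * 4 ^ r * (r * (1 - ((d' : ℝ) - B) ^ 2 / B ^ 2)) ≤
        Finset.univ.expect fun ω : Fin R → Fin n × Fin n =>
          bumpValue (prefixWeight β ρ ω) r (x₀ + j * 4 ^ r) z d' := by
      intro j z d' hj hd' hz
      refine ih (x₀ + j * 4 ^ r) z d' hd' (by omega) ?_ ((Nat.mul_le_mul_left _ hz).trans hR)
      have := Nat.mul_le_mul_right (4 ^ r) hj
      omega
    have a1 := ih' 0 h₀ d (by norm_num) hd (by nlinarith [Nat.zero_le (d * 4 ^ r)])
    have a2 := ih' 1 (h₀ + d * 4 ^ r) d (by norm_num) hd (by nlinarith [Nat.zero_le (d * 4 ^ r)])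
    have a3 := ih' 2 (h₀ + 2 * d * 4 ^ r) d (by norm_num) hd
      (by nlinarith [Nat.zero_le (d * 4 ^ r)])
    have a4 := ih' 3 (h₀ + 3 * d * 4 ^ r) d (by norm_num) hd
      (by nlinarith [Nat.zero_le (d * 4 ^ r)])
    rw [zero_mul, add_zero] at a1
    rw [one_mul] at a2
    -- At the extreme slopes the potential vanishes, so no gain is needed and the straight option
    -- suffices.
    by_cases hend : d = 0 ∨ d = 2 * B
    · have h1 := Finset.expect_le_expect (s := Finset.univ)
        (fun (ω : Fin R → Fin n × Fin n) _ => le_bumpValue_succ (prefixWeight β ρ ω) r x₀ h₀ d)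
      simp only [Finset.expect_add_distrib] at h1
      have h0 : 1 - ((d : ℝ) - B) ^ 2 / B ^ 2 = 0 := by
        rcases hend with rfl | rfl
        · push_cast; field_simp; ring
        · push_cast; field_simp; ring
      rw [h0] at a1 a2 a3 a4 ⊢
      simp only [mul_zero] at *
      linarith
    · have hd0 : 1 ≤ d := by omega
      have hd1 : d + 1 ≤ 2 * B := by omega
      have hdw : 4 ^ r ≤ d * 4 ^ r := Nat.le_mul_of_pos_left _ hd0
      obtain ⟨d', rfl⟩ : ∃ d', d = d' + 1 := ⟨d - 1, by omega⟩
      have hw2 := Nat.zero_le (d' * 4 ^ r)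
      have b1 := ih' 0 h₀ (d' + 1 + 1) (by norm_num) hd1 (by linarith [hw2, Nat.zero_le (4 ^ r)])
      have b2 := ih' 1 (h₀ + (d' + 1 + 1) * 4 ^ r) (d' + 1) (by norm_num) hd (by linarith [hw2, Nat.zero_le (4 ^ r)])
      have b3 := ih' 2 (h₀ + (2 * (d' + 1) + 1) * 4 ^ r) (d' + 1) (by norm_num) hd (by linarith [hw2, Nat.zero_le (4 ^ r)])
      have b4 := ih' 3 (h₀ + (3 * (d' + 1) + 1) * 4 ^ r) d' (by norm_num) (by omega)
        (by linarith [hw2, Nat.zero_le (4 ^ r)])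
      rw [zero_mul, add_zero] at b1
      rw [one_mul] at b2
      have hmain := expect_bumpValue_succ_ge hn hβ ha hv hx' hR' (by omega)
      refine le_trans ?_ hmain
      simp only [Finset.expect_add_distrib, Nat.add_sub_cancel]
      have hs0 : 0 ≤ s := Real.sqrt_nonneg _
      have hrB : (r : ℝ) ≤ 2 * B ^ 2 := by
        have : r ≤ 2 * B ^ 2 := by omega
        exact_mod_cast this
      -- In units of `s * 4 ^ r`: the gain is `3 / 16`, the growth of the potential costs at most `1
      -- / 8`, and its concavity in `d` costs `r / (32 * B ^ 2) ≤ 1 / 16`.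
      have hfin : s / 32 * 4 ^ (r + 1) *
            (((r + 1 : ℕ) : ℝ) * (1 - (((d' + 1 : ℕ) : ℝ) - B) ^ 2 / B ^ 2)) ≤
          1 / 2 * (6 * (s / 32 * 4 ^ r * (r * (1 - (((d' + 1 : ℕ) : ℝ) - B) ^ 2 / B ^ 2))) +
            s / 32 * 4 ^ r * (r * (1 - (((d' + 1 + 1 : ℕ) : ℝ) - B) ^ 2 / B ^ 2)) +
            s / 32 * 4 ^ r * (r * (1 - ((d' : ℝ) - B) ^ 2 / B ^ 2)) + 3 / 8 * (s * 4 ^ r)) := by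
        have hsw : 0 ≤ s * 4 ^ r := by positivity
        have hq : (r : ℝ) / B ^ 2 ≤ 2 := by rw [div_le_iff₀ (by positivity)]; exact hrB
        have hp : 0 ≤ (((d' + 1 : ℕ) : ℝ) - B) ^ 2 / (B : ℝ) ^ 2 := by positivity
        have hid : 1 / 2 * (6 * (s / 32 * 4 ^ r * (r * (1 - (((d' + 1 : ℕ) : ℝ) - B) ^ 2 / B ^ 2))) +
            s / 32 * 4 ^ r * (r * (1 - (((d' + 1 + 1 : ℕ) : ℝ) - B) ^ 2 / B ^ 2)) +
            s / 32 * 4 ^ r * (r * (1 - ((d' : ℝ) - B) ^ 2 / B ^ 2)) + 3 / 8 * (s * 4 ^ r)) -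
            s / 32 * 4 ^ (r + 1) *
            (((r + 1 : ℕ) : ℝ) * (1 - (((d' + 1 : ℕ) : ℝ) - B) ^ 2 / B ^ 2)) =
            s * 4 ^ r * (1 / 16 + (((d' + 1 : ℕ) : ℝ) - B) ^ 2 / (B : ℝ) ^ 2 / 8 -
              (r : ℝ) / B ^ 2 / 32) := by
          push_cast; field_simp; ring
        have : 0 ≤ s * 4 ^ r * (1 / 16 + (((d' + 1 : ℕ) : ℝ) - B) ^ 2 / (B : ℝ) ^ 2 / 8 -
              (r : ℝ) / B ^ 2 / 32) := mul_nonneg hsw (by linarith)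
        linarith
      linarith

end Growth

/-! ### Continuous staircase paths -/

section Paths

theorem MonotonePath.mem_range_le {p q w : ℝ × ℝ} (γ : MonotonePath p q)
    (hw : w ∈ Set.range γ.1) : p ≤ w ∧ w ≤ q := by
  obtain ⟨s, rfl⟩ := hw
  constructor
  · simpa using γ.2 (show (0 : unitInterval) ≤ s from unitInterval.nonneg')
  · simpa using γ.2 (show s ≤ (1 : unitInterval) from unitInterval.le_one')

theorem MonotonePath.exists_trans {p q r : ℝ × ℝ} (γ : MonotonePath p q) (γ' : MonotonePath q r) :
    ∃ γ'' : MonotonePath p r, Set.range γ''.1 = Set.range γ.1 ∪ Set.range γ'.1 := by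
  refine ⟨⟨γ.1.trans γ'.1, ?_⟩, Path.trans_range _ _⟩
  intro s s' hs
  have hs' : (s : ℝ) ≤ s' := hs
  rw [Path.trans_apply, Path.trans_apply]
  split_ifs with h1 h2 h2
  · exact γ.2 (Subtype.mk_le_mk.2 (by linarith))
  · exact (γ.mem_range_le ⟨_, rfl⟩).2.trans (γ'.mem_range_le ⟨_, rfl⟩).1
  · linarith
  · exact γ'.2 (Subtype.mk_le_mk.2 (by linarith))

theorem strictlyBeneath_iff {p q z : ℝ × ℝ} (γ : MonotonePath p q) :
    StrictlyBeneath γ z ↔ (∃ w ∈ Set.range γ.1, w.1 = z.1) ∧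
      ∀ w ∈ Set.range γ.1, w.1 = z.1 → z.2 < w.2 := by
  simp only [StrictlyBeneath, Set.exists_range_iff, Set.forall_mem_range]

/-- The staircase with height `H c` over the column `c`. -/
theorem exists_staircase (a T N : ℕ) (H : ℕ → ℕ)
    (hmono : ∀ c c', a ≤ c → c ≤ c' → c' < a + T → H c ≤ H c')
    (hN : ∀ c, a ≤ c → c < a + T → H c ≤ N) :
    ∃ γ : MonotonePath ((a : ℝ), (1 : ℝ)) (((a + T : ℕ) : ℝ), (N : ℝ) + 1),
      ∀ c k : ℕ, StrictlyBeneath γ ((c : ℝ) + 1, (k : ℝ) + 1) ↔ a ≤ c ∧ c < a + T ∧ k < H c := by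
  induction T generalizing N with
  | zero =>
    obtain ⟨γ⟩ := monotonePath_nonempty (p := ((a : ℝ), (1 : ℝ)))
      (q := (((a + 0 : ℕ) : ℝ), (N : ℝ) + 1)) ⟨by simp, by simp⟩
    refine ⟨γ, fun c k => ⟨fun h => ?_, fun h => by omega⟩⟩
    rw [strictlyBeneath_iff] at h
    obtain ⟨⟨w, hw, hwz⟩, h2⟩ := h
    have hb := γ.mem_range_le hw
    have e1 : w.1 = a := le_antisymm (by simpa using hb.2.1) hb.1.1
    have := h2 ((a : ℝ), (1 : ℝ)) ⟨0, γ.1.source⟩ (by rw [← hwz, e1])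
    have hk : (0 : ℝ) ≤ k := Nat.cast_nonneg k
    simp only at this
    linarith
  | succ T ih =>
    obtain ⟨γ, hγ⟩ := ih (H (a + T)) (fun c c' h1 h2 h3 => hmono c c' h1 h2 (by omega))
      (fun c h1 h2 => hmono c (a + T) h1 h2.le (by omega))
    obtain ⟨γh⟩ := monotonePath_nonempty (p := (((a + T : ℕ) : ℝ), (H (a + T) : ℝ) + 1))
      (q := (((a + (T + 1) : ℕ) : ℝ), (H (a + T) : ℝ) + 1)) ⟨by simp, le_rfl⟩
    have hNT : (H (a + T) : ℝ) ≤ N := by exact_mod_cast hN (a + T) (by omega) (by omega)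
    obtain ⟨γv⟩ := monotonePath_nonempty (p := (((a + (T + 1) : ℕ) : ℝ), (H (a + T) : ℝ) + 1))
      (q := (((a + (T + 1) : ℕ) : ℝ), (N : ℝ) + 1)) ⟨le_rfl, by simpa using hNT⟩
    obtain ⟨γ', hγ'⟩ := MonotonePath.exists_trans γh γv
    obtain ⟨γ'', hγ''⟩ := MonotonePath.exists_trans γ γ'
    have hext : ∀ w ∈ Set.range γ'.1, ((a + T : ℕ) : ℝ) ≤ w.1 ∧ w.1 ≤ ((a + (T + 1) : ℕ) : ℝ) ∧
        (H (a + T) : ℝ) + 1 ≤ w.2 := fun w hw =>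
      ⟨(γ'.mem_range_le hw).1.1, (γ'.mem_range_le hw).2.1, (γ'.mem_range_le hw).1.2⟩
    -- The dots of column `a + T` have the abscissa of this corner, the lowest point of the path
    -- there, so it alone decides which of them are beneath.
    have hcorner : (((a + (T + 1) : ℕ) : ℝ), (H (a + T) : ℝ) + 1) ∈ Set.range γ'.1 := by
      rw [hγ']; exact Or.inr ⟨0, γv.1.source⟩
    have hend : (((a + T : ℕ) : ℝ), (H (a + T) : ℝ) + 1) ∈ Set.range γ.1 := ⟨1, γ.1.target⟩
    refine ⟨γ'', fun c k => ?_⟩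
    rw [strictlyBeneath_iff, hγ'']
    have hγck := hγ c k
    rw [strictlyBeneath_iff] at hγck
    rcases lt_trichotomy c (a + T) with hc | hc | hc
    · have hc' : (c : ℝ) + 1 ≤ ((a + T : ℕ) : ℝ) := by exact_mod_cast hc
      rw [show (a ≤ c ∧ c < a + (T + 1) ∧ k < H c) ↔ (a ≤ c ∧ c < a + T ∧ k < H c) by omega,
        ← hγck]
      constructor
      · rintro ⟨⟨w, hw | hw, hwz⟩, h2⟩
        · exact ⟨⟨w, hw, hwz⟩, fun w hw => h2 w (Or.inl hw)⟩
        · refine ⟨⟨_, hend, ?_⟩, fun w hw => h2 w (Or.inl hw)⟩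
          have := (hext w hw).1
          simp only at hwz ⊢
          linarith
      · rintro ⟨⟨w, hw, hwz⟩, h2⟩
        refine ⟨⟨w, Or.inl hw, hwz⟩, ?_⟩
        rintro w' (hw' | hw') hwz'
        · exact h2 w' hw' hwz'
        · have h3 := hext w' hw'
          simp only at hwz' ⊢
          have := h2 _ hend (by simp only; linarith)
          simp only at this
          linarith
    · subst hc
      have hlt : ∀ w ∈ Set.range γ.1, w.1 < ((a + T : ℕ) : ℝ) + 1 := fun w hw =>
        lt_of_le_of_lt (γ.mem_range_le hw).2.1 (by simp)
      have hT : ((a + (T + 1) : ℕ) : ℝ) = ((a + T : ℕ) : ℝ) + 1 := by push_cast; ring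
      constructor
      · rintro ⟨-, h2⟩
        have := h2 _ (Or.inr hcorner) hT
        simp only [add_lt_add_iff_right, Nat.cast_lt] at this
        omega
      · rintro ⟨-, -, hk⟩
        have hk' : (k : ℝ) < H (a + T) := by exact_mod_cast hk
        refine ⟨⟨_, Or.inr hcorner, hT⟩, ?_⟩
        rintro w (hw | hw) hwz
        · exact absurd hwz (hlt w hw).ne
        · have := (hext w hw).2.2
          simp only
          linarith
    · have hc' : ((a + (T + 1) : ℕ) : ℝ) < (c : ℝ) + 1 := by
        have : a + (T + 1) < c + 1 := by omega
        exact_mod_cast this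
      refine ⟨fun h => ?_, fun h => by omega⟩
      obtain ⟨⟨w, hw, hwz⟩, -⟩ := h
      rw [← hγ''] at hw
      have := (γ''.mem_range_le hw).2.1
      simp only at hwz this
      linarith

theorem pathSurplus_eq_sum {U : Type*} {n N : ℕ} (g : U → Fin n) (o : Fin N → Operation U)
    {p q : ℝ × ℝ} (γ : MonotonePath p q) {S : Fin N → Prop} [DecidablePred S]
    (hS : ∀ k, StrictlyBeneath γ (dot g o k) ↔ S k) :
    (pathSurplus g o γ : ℝ) =
      ∑ k, (if (o k).isInsertion then (1 : ℝ) else -1) * if S k then 1 else 0 := by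
  classical
  unfold pathSurplus
  simp only [hS]
  push_cast
  rw [Finset.natCast_card_filter, Finset.natCast_card_filter, ← Finset.sum_sub_distrib]
  refine Finset.sum_congr rfl fun k _ => ?_
  cases (o k).isInsertion <;> by_cases h : S k <;> simp [h]

theorem sum_le_intervalSurplus {U : Type*} {n N : ℕ} (g : U → Fin n) (o : Fin N → Operation U)
    (a T : ℕ) (H : ℕ → ℕ) (hmono : ∀ c c', a ≤ c → c ≤ c' → c' < a + T → H c ≤ H c')
    (hN : ∀ c, a ≤ c → c < a + T → H c ≤ N) :
    ∑ k : Fin N, (if (o k).isInsertion then (1 : ℝ) else -1) *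
      (if a ≤ (g (o k).key : ℕ) ∧ (g (o k).key : ℕ) < a + T ∧ (k : ℕ) < H (g (o k).key)
        then 1 else 0) ≤ intervalSurplus g o (a + 1) (a + T) := by
  obtain ⟨γ, hγ⟩ := exists_staircase a T N H hmono hN
  rw [← pathSurplus_eq_sum g o γ (fun k => hγ _ _)]
  have hg := (intervalSurplus_isGreatest g o (a + 1) (a + T) (by omega)).2
  have he : ((a : ℝ), (1 : ℝ)) = (((a + 1 : ℕ) : ℝ) - 1, (1 : ℝ)) := by push_cast; simp
  have : ∀ p : ℝ × ℝ, ((a : ℝ), (1 : ℝ)) = p →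
      ∃ γ' : MonotonePath p (((a + T : ℕ) : ℝ), (N : ℝ) + 1),
        pathSurplus g o γ' = pathSurplus g o γ := by
    rintro p rfl; exact ⟨γ, rfl⟩
  obtain ⟨γ', hγ'⟩ := this _ he
  rw [← hγ']
  exact_mod_cast hg ⟨γ', rfl⟩

end Paths

/-! ### Pairs of operations and reduction to uniform columns -/

section Pairing

variable {U : Type*} {n R : ℕ}

/-- The position of the insertion (`b = true`) or the deletion (`b = false`) among the operations
`2 * k` and `2 * k + 1`. -/
def pairIndex (o : Fin (2 * R) → Operation U) (p : Fin R × Bool) : Fin (2 * R) :=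
  if (o ⟨2 * p.1, by omega⟩).isInsertion = p.2 then ⟨2 * p.1, by omega⟩ else ⟨2 * p.1 + 1, by omega⟩

theorem pairIndex_div (o : Fin (2 * R) → Operation U) (p : Fin R × Bool) :
    (pairIndex o p : ℕ) / 2 = p.1 := by
  unfold pairIndex
  split_ifs <;> (simp; try omega)

theorem isInsertion_pairIndex {o : Fin (2 * R) → Operation U} (ho : IsAlternating o)
    (p : Fin R × Bool) : (o (pairIndex o p)).isInsertion = p.2 := by
  unfold pairIndex
  split_ifs with h
  · exact h
  · have := ho ⟨2 * p.1, by omega⟩ ⟨2 * p.1 + 1, by omega⟩ rfl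
    revert this h
    cases p.2 <;> cases (o ⟨2 * p.1, by omega⟩).isInsertion <;>
      cases (o ⟨2 * p.1 + 1, by omega⟩).isInsertion <;> simp

theorem pairIndex_injective {o : Fin (2 * R) → Operation U} (ho : IsAlternating o) :
    Function.Injective (pairIndex o) := by
  intro p q h
  refine Prod.ext (Fin.ext ?_) ?_
  · rw [← pairIndex_div o p, ← pairIndex_div o q, h]
  · rw [← isInsertion_pairIndex ho p, ← isInsertion_pairIndex ho q, h]

/-- The operations, grouped in pairs of an insertion and a deletion. -/
noncomputable def pairEquiv {o : Fin (2 * R) → Operation U} (ho : IsAlternating o) :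
    Fin R × Bool ≃ Fin (2 * R) :=
  Equiv.ofBijective (pairIndex o)
    ((Fintype.bijective_iff_injective_and_card _).2 ⟨pairIndex_injective ho, by simp [mul_comm]⟩)

theorem sum_pairs {o : Fin (2 * R) → Operation U} (ho : IsAlternating o)
    (F : Fin (2 * R) → ℝ) :
    ∑ k, F k = ∑ k : Fin R, (F (pairIndex o (k, true)) + F (pairIndex o (k, false))) := by
  rw [← Fintype.sum_equiv (pairEquiv ho) (fun p => F (pairIndex o p)) F (fun _ => rfl),
    Fintype.sum_prod_type]
  simp

/-- The columns of the dots, grouped in pairs. -/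
def pairColumns (g : U → Fin n) (o : Fin (2 * R) → Operation U) (k : Fin R) : Fin n × Fin n :=
  (g (o (pairIndex o (k, true))).key, g (o (pairIndex o (k, false))).key)

/-- Columns from `a₁` on, cut into blocks of `b` columns; the columns to the left get the
number `P`. -/
def blockIndex (a₁ b P : ℕ) (c : Fin n) : ℕ :=
  if a₁ ≤ (c : ℕ) then (c - a₁) / b else P

theorem card_blockIndex {a₁ b P x : ℕ} (hb : 0 < b) (hn : a₁ + b * P ≤ n) (hx : x < P) :
    (Finset.univ.filter fun c : Fin n => blockIndex a₁ b P c = x).card = b := by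
  have : (Finset.Ico (a₁ + b * x) (a₁ + b * x + b)).card = b := by simp
  rw [← Finset.card_map Fin.valEmbedding]
  refine Eq.trans (congrArg _ ?_) this
  ext c
  have h1 : b * x + b ≤ b * P := by
    rw [← Nat.mul_succ]; exact Nat.mul_le_mul_left _ hx
  simp only [Finset.mem_Ico, Finset.mem_map, Finset.mem_filter, Finset.mem_univ, true_and,
    Fin.valEmbedding_apply]
  have key : ∀ c, a₁ ≤ c → ((c - a₁) / b = x ↔ a₁ + b * x ≤ c ∧ c < a₁ + b * x + b) := by
    intro c hc
    rw [Nat.div_eq_iff hb]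
    have : x * b = b * x := mul_comm _ _
    omega
  constructor
  · rintro ⟨y, hy, rfl⟩
    unfold blockIndex at hy
    split_ifs at hy with h
    · exact (key _ h).1 hy
    · omega
  · intro h
    have h0 : a₁ ≤ c := by have := Nat.zero_le (b * x); omega
    exact ⟨⟨c, by omega⟩, (if_pos h0).trans ((key _ h0).2 h), rfl⟩

/-- A monotone path on the grid of blocks gives a lower bound for the surplus. -/
theorem sum_prefixWeight_le_intervalSurplus (g : U → Fin n) {o : Fin (2 * R) → Operation U}
    (ho : IsAlternating o) {a T a₁ b P ρ : ℕ} (hb : 0 < b) (ha : a ≤ a₁) (haT : a₁ + b * P = a + T)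
    (H : ℕ → ℕ) (hmono : ∀ x y, x ≤ y → y < P → H x ≤ H y) (hH : ∀ x < P, ρ * H x ≤ R) :
    ∑ x ∈ Finset.range P, prefixWeight (blockIndex a₁ b P) ρ (pairColumns g o) x (H x) ≤
      intervalSurplus g o (a + 1) (a + T) := by
  have hblock : ∀ c, a₁ ≤ c → c < a + T → (c - a₁) / b < P := fun c h1 h2 => by
    rw [Nat.div_lt_iff_lt_mul hb, mul_comm]; omega
  refine le_trans (le_of_eq ?_) (sum_le_intervalSurplus g o a T
    -- Even heights never separate the two operations of a pair. Height `0` on the unused columns at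
    -- the left keeps the path monotone and collects no dots.
    (fun c => if a₁ ≤ c then 2 * (ρ * H ((c - a₁) / b)) else 0) ?_ ?_)
  · rw [sum_pairs ho]
    simp only [prefixWeight]
    rw [Finset.sum_comm]
    refine Finset.sum_congr rfl fun k _ => ?_
    simp only [isInsertion_pairIndex ho, if_true, Bool.false_eq_true, if_false, one_mul, neg_mul]
    have key : ∀ (p : Fin R × Bool) (c : Fin n),
        (if a ≤ (c : ℕ) ∧ (c : ℕ) < a + T ∧ (pairIndex o p : ℕ) <
          (if a₁ ≤ (c : ℕ) then 2 * (ρ * H ((c - a₁) / b)) else 0) then (1 : ℝ) else 0) =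
        ∑ x ∈ Finset.range P, if (p.1 : ℕ) < ρ * H x then
          (if blockIndex a₁ b P c = x then (1 : ℝ) else 0) else 0 := by
      intro p c
      have hp := pairIndex_div o p
      have hcomm : ∀ x, (if (p.1 : ℕ) < ρ * H x then
          (if blockIndex a₁ b P c = x then (1 : ℝ) else 0) else 0) =
          if blockIndex a₁ b P c = x then (if (p.1 : ℕ) < ρ * H x then (1 : ℝ) else 0) else 0 := by
        intro x; split_ifs <;> rfl
      simp only [hcomm, Finset.sum_ite_eq, Finset.mem_range]
      unfold blockIndex
      by_cases h1 : a₁ ≤ (c : ℕ)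
      · simp only [h1, if_true]
        by_cases h2 : (c : ℕ) < a + T
        · rw [if_pos (hblock _ h1 h2)]
          refine if_congr ?_ rfl rfl
          omega
        · have : ¬ ((c : ℕ) - a₁) / b < P := by
            rw [Nat.div_lt_iff_lt_mul hb, mul_comm]; omega
          simp [h2, this]
      · simp [h1]
    rw [key (k, true), key (k, false), ← sub_eq_add_neg, ← Finset.sum_sub_distrib]
    refine Finset.sum_congr rfl fun x _ => ?_
    have hw : blockWeight (blockIndex a₁ b P) x (pairColumns g o k) =
        (if blockIndex a₁ b P (g (o (pairIndex o (k, true))).key) = x then 1 else 0) -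
        (if blockIndex a₁ b P (g (o (pairIndex o (k, false))).key) = x then 1 else 0) := rfl
    rw [hw]
    by_cases hk : (k : ℕ) < ρ * H x <;> simp [hk]
  · intro c c' h1 h2 h3
    by_cases h : a₁ ≤ c
    · simp only [h, h.trans h2, if_true]
      have := hmono ((c - a₁) / b) ((c' - a₁) / b) (Nat.div_le_div_right (by omega))
        (hblock c' (h.trans h2) h3)
      gcongr
    · simp [h]
  · intro c h1 h2
    split_ifs with h
    · have := hH _ (hblock c h h2)
      omega
    · omega

/-- The columns of the dots, recovered from their pairs. -/
noncomputable def unpairColumns {o : Fin (2 * R) → Operation U} (ho : IsAlternating o)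
    (w : Fin R → Fin n × Fin n) (i : Fin (2 * R)) : Fin n :=
  if ((pairEquiv ho).symm i).2 then (w ((pairEquiv ho).symm i).1).1
  else (w ((pairEquiv ho).symm i).1).2

/-- The same operations on the keys `0, 1, 2, …`. -/
def relabel (o : Fin (2 * R) → Operation U) (i : Fin (2 * R)) : Operation (Fin (2 * R)) :=
  ⟨(o i).isInsertion, i⟩

theorem relabel_isAlternating {o : Fin (2 * R) → Operation U} (ho : IsAlternating o) :
    IsAlternating (relabel o) := ho

theorem unpairColumns_pairIndex {o : Fin (2 * R) → Operation U} (ho : IsAlternating o)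
    (w : Fin R → Fin n × Fin n) (p : Fin R × Bool) :
    unpairColumns ho w (pairIndex o p) = if p.2 then (w p.1).1 else (w p.1).2 := by
  have : (pairEquiv ho).symm (pairIndex o p) = p := (pairEquiv ho).symm_apply_apply p
  rw [unpairColumns, this]

theorem pairColumns_unpairColumns {o : Fin (2 * R) → Operation U} (ho : IsAlternating o)
    (w : Fin R → Fin n × Fin n) : pairColumns (unpairColumns ho w) (relabel o) = w := by
  funext k
  exact Prod.ext (unpairColumns_pairIndex ho w (k, true)) (unpairColumns_pairIndex ho w (k, false))

theorem unpairColumns_pairColumns (g : U → Fin n) {o : Fin (2 * R) → Operation U}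
    (ho : IsAlternating o) :
    unpairColumns ho (pairColumns g o) = fun i => g (o i).key := by
  funext i
  obtain ⟨⟨k, b⟩, rfl⟩ := (pairEquiv ho).surjective i
  change unpairColumns ho (pairColumns g o) (pairIndex o (k, b)) = g (o (pairIndex o (k, b))).key
  rw [unpairColumns_pairIndex]
  cases b <;> rfl

/-- The surplus sees only the hashes of the keys in use, hence is a function on a finite space,
whatever `U` is. -/
theorem intervalSurplus_eq (g : U → Fin n) {o : Fin (2 * R) → Operation U}
    (ho : IsAlternating o) (i j : ℕ) :
    intervalSurplus g o i j =
      intervalSurplus (unpairColumns ho (pairColumns g o)) (relabel o) i j := by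
  rw [unpairColumns_pairColumns]
  rfl

/-- The columns of the dots of a fully random hash function are uniform. -/
theorem integral_pairColumns {Ω : Type*} [MeasurableSpace Ω] {P : Measure Ω}
    [IsProbabilityMeasure P] {h : U → Ω → Fin n} (hh : IsFullyRandomHash P n h)
    {o : Fin (2 * R) → Operation U} (ho : IsAlternating o)
    (hinj : Function.Injective fun k => (o k).key) (F : (Fin R → Fin n × Fin n) → ℝ) :
    ∫ ω, F (pairColumns (fun u => h u ω) o) ∂P = Finset.univ.expect F := by
  have hmeas : Measurable fun ω => pairColumns (fun u => h u ω) o :=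
    measurable_pi_lambda _ fun k => (hh.measurable _).prodMk (hh.measurable _)
  have hindep : iIndepFun (fun i => h (o i).key) P := hh.indep.precomp hinj
  have hprob : ∀ w, P.real ((fun ω => pairColumns (fun u => h u ω) o) ⁻¹' {w}) =
      ((Fintype.card (Fin R → Fin n × Fin n) : ℝ))⁻¹ := by
    intro w
    have hset : ((fun ω => pairColumns (fun u => h u ω) o) ⁻¹' {w}) =
        ⋂ i ∈ (Finset.univ : Finset (Fin (2 * R))), h (o i).key ⁻¹' {unpairColumns ho w i} := by
      ext ω
      simp only [Set.mem_preimage, Set.mem_singleton_iff, Finset.mem_univ, Set.iInter_true,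
        Set.mem_iInter]
      constructor
      · rintro rfl i
        rw [unpairColumns_pairColumns]
      · intro hi
        rw [← pairColumns_unpairColumns ho w]
        exact funext fun k => Prod.ext (hi _) (hi _)
    rw [hset, Measure.real, hindep.measure_inter_preimage_eq_mul Finset.univ
      (fun i _ => measurableSet_singleton _)]
    simp only [hh.uniform, Finset.prod_const, Finset.card_univ, Fintype.card_fin,
      ENNReal.toReal_pow, ENNReal.toReal_inv, ENNReal.toReal_natCast, Fintype.card_pi,
      Fintype.card_prod]
    push_cast
    rw [inv_pow, pow_mul, sq]
  rw [← integral_map (φ := fun ω => pairColumns (fun u => h u ω) o) (f := F) hmeas.aemeasurable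
    (Measurable.of_discrete).aestronglyMeasurable, integral_fintype (.of_finite)]
  have : ∀ w, (P.map fun ω => pairColumns (fun u => h u ω) o).real {w} =
      ((Fintype.card (Fin R → Fin n × Fin n) : ℝ))⁻¹ := fun w => by
    rw [map_measureReal_apply hmeas (measurableSet_singleton _), hprob]
  simp only [this, smul_eq_mul]
  rw [← Finset.mul_sum, Fintype.expect_eq_sum_div_card, div_eq_inv_mul]

theorem expect_le_integral_intervalSurplus {Ω : Type*} [MeasurableSpace Ω] {P : Measure Ω}
    [IsProbabilityMeasure P] {h : U → Ω → Fin n} (hh : IsFullyRandomHash P n h)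
    {o : Fin (2 * R) → Operation U} (ho : IsAlternating o)
    (hinj : Function.Injective fun k => (o k).key) (i j : ℕ)
    (G : (Fin R → Fin n × Fin n) → ℝ)
    (hG : ∀ w, G w ≤ intervalSurplus (unpairColumns ho w) (relabel o) i j) :
    Finset.univ.expect G ≤ ∫ ω, (intervalSurplus (fun u => h u ω) o i j : ℝ) ∂P := by
  simp only [intervalSurplus_eq _ ho]
  rw [integral_pairColumns hh ho hinj
    fun w => (intervalSurplus (unpairColumns ho w) (relabel o) i j : ℝ)]
  exact Finset.expect_le_expect fun w _ => hG w

end Pairing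

/-! ### Two lower bounds for the expected surplus -/

section LowerBounds

variable {U Ω : Type*} [MeasurableSpace Ω] {P : Measure Ω} [IsProbabilityMeasure P] {n R : ℕ}
  {h : U → Ω → Fin n} {o : Fin (2 * R) → Operation U}

/-- The bound from the choice between the lowest and the highest path. -/
theorem integral_intervalSurplus_ge_sqrt (hh : IsFullyRandomHash P n h) (ho : IsAlternating o)
    (hinj : Function.Injective fun k => (o k).key) {a T t : ℕ} (ht : t ≤ T) (haT : a + T ≤ n)
    (htn : 2 * t ≤ n) (hv : 1 ≤ (t : ℝ) * R / n) :
    3 / 16 * √((t : ℝ) * R / n) ≤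
      ∫ ω, (intervalSurplus (fun u => h u ω) o (a + 1) (a + T) : ℝ) ∂P := by
  have ht0 : 0 < t := Nat.pos_of_ne_zero fun h0 => by
    rw [h0] at hv; norm_num at hv
  have hn : 0 < n := by omega
  set β : Fin n → ℕ := blockIndex (a + T - t) t 1 with hβ
  have hcard : ∀ x < 1, (Finset.univ.filter fun c => β c = x).card = t := fun x hx =>
    card_blockIndex ht0 (by omega) hx
  refine le_trans ?_ (expect_le_integral_intervalSurplus hh ho hinj _ _
    (fun w => max 0 (prefixWeight β 1 w 0 R)) ?_)
  -- The region is the whole block of the last `t` columns, and the two options are to pass below or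
  -- above all of its dots.
  · set D : StripRegion := ⟨{0}, fun _ => 0, fun _ => R⟩ with hD
    have := D.expect_max_ge β (R := R) (a := t) (v := (t : ℝ) * R / n) hn
      (fun x hx => hcard x (by simp [hD] at hx; omega)) (by simpa [hD] using htn)
      (fun x hx => le_rfl) hv (le_of_eq (by simp [hD]; ring)) (fun _ => 0)
      (fun w => prefixWeight β 1 w 0 R) (fun _ => rfl) (fun w => ?_)
    · rw [expect_prefixWeight hn] at this
      simp only [Finset.expect_const_zero, add_zero] at this
      linarith
    · rw [D.prefixWeight_flip_of_subset β (by simp [hD]) (fun k _ hk => by simpa using hk)]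
      congr 2
      refine Finset.sum_congr rfl fun k _ => ?_
      rw [← D.sum_columnWeight β]
      simp [hD]
  · intro w
    have key : ∀ H : ℕ, H ≤ R → prefixWeight β 1 w 0 H ≤
        intervalSurplus (unpairColumns ho w) (relabel o) (a + 1) (a + T) := by
      intro H hH
      have := sum_prefixWeight_le_intervalSurplus (unpairColumns ho w) (relabel_isAlternating ho)
        (a := a) (T := T) (a₁ := a + T - t) (b := t) (P := 1) (ρ := 1) ht0 (by omega) (by omega)
        (fun _ => H) (fun _ _ _ _ => le_rfl) (fun _ _ => by omega)
      rw [pairColumns_unpairColumns] at this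
      simpa using this
    refine max_le ?_ (key R le_rfl)
    have := key 0 (Nat.zero_le _)
    simpa [prefixWeight] using this

/-- The bound from the multiscale paths. -/
theorem integral_intervalSurplus_ge_multiscale (hh : IsFullyRandomHash P n h)
    (ho : IsAlternating o) (hinj : Function.Injective fun k => (o k).key) {a T t B : ℕ}
    (ht : t ≤ T) (haT : a + T ≤ n) (htn : 2 * t ≤ n) (hB : 0 < B) (hP : 4 ^ (2 * B ^ 2) ≤ t)
    (hv : 1 ≤ ((t / 4 ^ (2 * B ^ 2) : ℕ) : ℝ) * (R / (B * 4 ^ (2 * B ^ 2)) : ℕ) / n) :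
    √(((t / 4 ^ (2 * B ^ 2) : ℕ) : ℝ) * (R / (B * 4 ^ (2 * B ^ 2)) : ℕ) / n) / 32 *
        4 ^ (2 * B ^ 2) * ((2 * B ^ 2 : ℕ) : ℝ) ≤
      ∫ ω, (intervalSurplus (fun u => h u ω) o (a + 1) (a + T) : ℝ) ∂P := by
  set L := 2 * B ^ 2 with hL
  set b := t / 4 ^ L with hb
  set ρ := R / (B * 4 ^ L) with hρ
  have hb0 : 0 < b := Nat.div_pos hP (by positivity)
  have hbP : b * 4 ^ L ≤ t := Nat.div_mul_le_self _ _
  have hρR : ρ * (B * 4 ^ L) ≤ R := Nat.div_mul_le_self _ _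
  have hn : 0 < n := by
    have : 0 < 4 ^ L := by positivity
    omega
  -- The blocks are aligned with the right end; columns lost to rounding are left out on the left.
  set β : Fin n → ℕ := blockIndex (a + T - b * 4 ^ L) b (4 ^ L) with hβ
  have hcard : ∀ x < 4 ^ L, (Finset.univ.filter fun c => β c = x).card = b := fun x hx =>
    card_blockIndex hb0 (by omega) hx
  have hmain := expect_bumpValue_ge (R := R) hn hcard (by omega) hv hB L 0 0 B (by omega) le_rfl
    (by omega) (by rw [zero_add]; exact hρR)
  rw [sub_self, zero_pow two_ne_zero, zero_div, sub_zero, mul_one] at hmain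
  refine hmain.trans (expect_le_integral_intervalSurplus hh ho hinj _ _ _ fun w => ?_)
  obtain ⟨H, h1, h2, h3⟩ := bumpValue_attained (prefixWeight β ρ w) L 0 0 B
  rw [h3]
  have := sum_prefixWeight_le_intervalSurplus (unpairColumns ho w) (relabel_isAlternating ho)
    (a := a) (T := T) (a₁ := a + T - b * 4 ^ L) (b := b) (P := 4 ^ L) (ρ := ρ) hb0 (by omega)
    (by omega) H (fun x y hxy hy => h1 x y (Nat.zero_le _) hxy (by omega)) (fun x hx =>
      (Nat.mul_le_mul_left _ (by simpa using (h2 x (Nat.zero_le _) (by omega)).2)).trans hρR)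
  rw [pairColumns_unpairColumns] at this
  simpa only [zero_add] using this

end LowerBounds

/-! ### Choice of the number of scales -/

section Parameters

theorem rpow_three_quarters {x : ℝ} (hx : 0 ≤ x) : x ^ (3 / 4 : ℝ) = √(√x) ^ 3 := by
  have h : x = √(√x) ^ 4 := by
    rw [show (4 : ℕ) = 2 * 2 by norm_num, pow_mul, Real.sq_sqrt (Real.sqrt_nonneg _),
      Real.sq_sqrt hx]
  conv_lhs => rw [h]
  rw [← Real.rpow_natCast, ← Real.rpow_mul (by positivity), ← Real.rpow_natCast]
  norm_num

/-- The number of scales can be taken of the order of `log m`. -/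
theorem exists_scale {m : ℝ} (hm : Real.exp 9 ≤ m) :
    ∃ B : ℕ, 0 < B ∧ ((4 : ℝ) ^ (2 * B ^ 2)) ^ 3 ≤ m ∧ √(Real.log m) ≤ 6 * B := by
  have hm0 : 0 < m := (Real.exp_pos _).trans_le hm
  have hlog : 9 ≤ Real.log m := (Real.le_log_iff_exp_le hm0).2 hm
  set y := √(Real.log m) with hy
  have hyy : y ^ 2 = Real.log m := Real.sq_sqrt (by linarith)
  have hy3 : 3 ≤ y := Real.le_sqrt_of_sq_le (by linarith)
  -- Since `4 ^ 2 ≤ exp 3`, the cube of `4 ^ (2 * B ^ 2)` is at most `exp (9 * B ^ 2)`, hence the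
  -- divisor `3`. Rounding down at most halves `y / 3 ≥ 1`, hence the `6`.
  refine ⟨⌊y / 3⌋₊, Nat.floor_pos.2 (by linarith), ?_, ?_⟩
  · set B := ⌊y / 3⌋₊
    have hB : (B : ℝ) ≤ y / 3 := Nat.floor_le (by positivity)
    have h16 : (4 : ℝ) ^ 2 ≤ Real.exp 3 := by
      have h1 := Real.exp_one_gt_d9
      have h2 : Real.exp 3 = Real.exp 1 ^ 3 := by rw [← Real.exp_nat_mul]; norm_num
      rw [h2]
      have h3 : (2.7 : ℝ) ^ 3 ≤ Real.exp 1 ^ 3 := by gcongr; linarith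
      norm_num at h3 ⊢
      linarith
    calc ((4 : ℝ) ^ (2 * B ^ 2)) ^ 3 = (((4 : ℝ) ^ 2) ^ B ^ 2) ^ 3 := by rw [pow_mul]
      _ ≤ (Real.exp 3 ^ B ^ 2) ^ 3 := by gcongr
      _ = Real.exp (9 * (B : ℝ) ^ 2) := by
          rw [← Real.exp_nat_mul, ← Real.exp_nat_mul]; push_cast; ring_nf
      _ ≤ Real.exp (Real.log m) := by
          gcongr
          rw [← hyy]
          have : (B : ℝ) ^ 2 ≤ (y / 3) ^ 2 := by gcongr
          linarith
      _ = m := Real.exp_log hm0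
  · have h1 : 1 ≤ ⌊y / 3⌋₊ := Nat.floor_pos.2 (by linarith)
    have h2 := Nat.lt_floor_add_one (y / 3)
    have h3 : (1 : ℝ) ≤ ⌊y / 3⌋₊ := by exact_mod_cast h1
    linarith

theorem div_two_mul_le_natDiv {t P : ℕ} (hP : 0 < P) (h : P ≤ t) :
    (t : ℝ) / (2 * P) ≤ (t / P : ℕ) := by
  have h1 : 1 ≤ t / P := Nat.div_pos h hP
  have h2 : t ≤ (t / P) * (2 * P) := by
    have := Nat.lt_div_mul_add (a := t) hP
    nlinarith
  rw [div_le_iff₀ (by positivity)]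
  exact_mod_cast h2

end Parameters

/-! ### Conclusion -/

section Main

theorem integral_intervalSurplus_ge_of_large {U Ω : Type*} [MeasurableSpace Ω] {P : Measure Ω}
    [IsProbabilityMeasure P] {n R : ℕ} {h : U → Ω → Fin n} {o : Fin (2 * R) → Operation U}
    (hh : IsFullyRandomHash P n h) (ho : IsAlternating o)
    (hinj : Function.Injective fun k => (o k).key) {a T t : ℕ} (ht : t ≤ T) (haT : a + T ≤ n)
    (htn : 2 * t ≤ n) {C m : ℝ} (hRC : (R : ℝ) ≤ C * n) (hm : m = √((t : ℝ) * R / n))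
    (hm9 : Real.exp 9 ≤ m) (hmC : C ≤ m) :
    1 / 512 * (m * Real.log m ^ (3 / 4 : ℝ)) ≤
      ∫ ω, (intervalSurplus (fun u => h u ω) o (a + 1) (a + T) : ℝ) ∂P := by
  have hm4 : 4 ≤ m := by
    have := Real.add_one_le_exp (9 : ℝ)
    linarith
  have hmsq : m ^ 2 = (t : ℝ) * R / n := by rw [hm, Real.sq_sqrt (by positivity)]
  have hn : (0 : ℝ) < n := by
    rcases Nat.eq_zero_or_pos n with h0 | h0
    · rw [h0] at hmsq; norm_num at hmsq; nlinarith
    · exact_mod_cast h0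
  have hmn : m ^ 2 * n = t * R := by rw [hmsq]; field_simp
  have htm : m ≤ t := by
    -- `R ≤ C * n ≤ m * n` forces `m ≤ t`, just as `2 * t ≤ n` forces `m ≤ R` below. Both dimensions
    -- therefore have room for the grid.
    have h1 : m ^ 2 * n ≤ t * (m * n) := by
      rw [hmn]
      have : (R : ℝ) ≤ m * n := hRC.trans (by gcongr)
      gcongr
    have h2 : m * (m * n) ≤ t * (m * n) := by linarith [h1, sq m, (by ring : m ^ 2 * n = m * (m * n))]
    exact le_of_mul_le_mul_right h2 (by positivity)
  have hRm : m ≤ R := by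
    have ht0 : (0 : ℝ) < t := by linarith
    have h1 : (t : ℝ) * m ≤ t * R := by
      rw [← hmn]
      have h2 : 2 * (t : ℝ) ≤ n := by exact_mod_cast htn
      have h3 : m ≤ m ^ 2 := by nlinarith
      calc (t : ℝ) * m ≤ n * m ^ 2 := by gcongr; linarith
        _ = _ := by ring
    exact le_of_mul_le_mul_left h1 ht0
  obtain ⟨B, hB, hB3, hBlog⟩ := exists_scale hm9
  set L := 2 * B ^ 2 with hL
  set Q : ℝ := (4 : ℝ) ^ L with hQ
  have hQ1 : 1 ≤ Q := one_le_pow₀ (by norm_num)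
  have hBQ : (B : ℝ) ≤ Q := by
    have h1 : B ≤ 4 ^ L := by
      have h2 : L < 4 ^ L := Nat.lt_pow_self (by norm_num)
      have h3 : B ≤ L := by rw [hL]; nlinarith
      omega
    rw [hQ]; exact_mod_cast h1
  have hBQ3 : B * Q ≤ Q ^ 3 := by
    calc B * Q ≤ Q * Q := by gcongr
      _ = Q ^ 2 := by ring
      _ ≤ Q ^ 3 := pow_le_pow_right₀ hQ1 (by norm_num)
  have hQm : Q ≤ m := (le_self_pow₀ hQ1 (by norm_num)).trans hB3
  have hPt : 4 ^ L ≤ t := by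
    have : ((4 ^ L : ℕ) : ℝ) ≤ t := by push_cast; linarith
    exact_mod_cast this
  have hPR : B * 4 ^ L ≤ R := by
    have : ((B * 4 ^ L : ℕ) : ℝ) ≤ R := by push_cast; linarith
    exact_mod_cast this
  have hB0 : (0 : ℝ) < B := by exact_mod_cast hB
  -- Each of the two roundings costs at most a factor two.
  have hvm : (m / (2 * √B * Q)) ^ 2 ≤
      ((t / 4 ^ L : ℕ) : ℝ) * (R / (B * 4 ^ L) : ℕ) / n := by
    have h1 := div_two_mul_le_natDiv (by positivity) hPt
    have h2 := div_two_mul_le_natDiv (by positivity) hPR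
    push_cast at h1 h2
    calc (m / (2 * √B * Q)) ^ 2 = (t / (2 * Q)) * (R / (2 * (B * Q))) / n := by
          rw [div_pow, hmsq, mul_pow, mul_pow, Real.sq_sqrt hB0.le]
          field_simp
      _ ≤ _ := by rw [hQ]; gcongr
  have hz0 : 0 < √(B : ℝ) := Real.sqrt_pos.2 hB0
  have hz2 : √(B : ℝ) ^ 2 = B := Real.sq_sqrt hB0.le
  -- The Khintchine bound needs variance at least one even at the smallest scale; `Q ^ 3 ≤ m`
  -- provides it.
  have hone : 1 ≤ (m / (2 * √B * Q)) ^ 2 := by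
    rw [div_pow, mul_pow, mul_pow, hz2, one_le_div (by positivity)]
    have : B * Q ^ 2 ≤ Q ^ 3 := by nlinarith [sq_nonneg Q]
    nlinarith
  refine le_trans ?_ (integral_intervalSurplus_ge_multiscale hh ho hinj ht haT htn hB hPt
    (hone.trans hvm))
  have hsqrt : m / (2 * √B * Q) ≤ √(((t / 4 ^ L : ℕ) : ℝ) * (R / (B * 4 ^ L) : ℕ) / n) :=
    Real.le_sqrt_of_sq_le hvm
  have hlog0 : 0 ≤ Real.log m := Real.log_nonneg (by linarith)
  rw [rpow_three_quarters hlog0]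
  set q := √(√(Real.log m)) with hq
  have hq0 : 0 ≤ q := Real.sqrt_nonneg _
  have hqz : q ≤ 5 / 2 * √B := by
    refine Real.sqrt_le_iff.2 ⟨by positivity, ?_⟩
    rw [mul_pow, hz2]
    linarith
  -- The constant works because `(5 / 2) ^ 3 / 512 = 125 / 4096 ≤ 1 / 32`.
  calc 1 / 512 * (m * q ^ 3) ≤ 1 / 512 * (m * (5 / 2 * √B) ^ 3) := by gcongr
    _ ≤ m * √B ^ 3 / 32 := by
        have : 0 ≤ m * √B ^ 3 := by positivity
        nlinarith
    _ = m / (2 * √B * Q) / 32 * Q * ((L : ℕ) : ℝ) := by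
        have hLB : ((L : ℕ) : ℝ) = 2 * √(B : ℝ) ^ 4 := by
          rw [hL]; push_cast
          rw [show √(B : ℝ) ^ 4 = (√(B : ℝ) ^ 2) ^ 2 by ring, hz2]
        rw [hLB]
        field_simp
    _ ≤ _ := by gcongr

theorem exists_integral_intervalSurplus_ge (C : ℝ) :
    ∃ c : ℝ, 0 < c ∧ ∀ {U Ω : Type*} [MeasurableSpace Ω] {P : Measure Ω} [IsProbabilityMeasure P]
      {n R : ℕ} {h : U → Ω → Fin n} {o : Fin (2 * R) → Operation U},
      IsFullyRandomHash P n h → IsAlternating o → Function.Injective (fun k => (o k).key) →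
      ∀ {a T t : ℕ}, t ≤ T → a + T ≤ n → 2 * t ≤ n → ∀ {m : ℝ}, (R : ℝ) ≤ C * n →
        m = √((t : ℝ) * R / n) → 1 ≤ m →
        c * (m * Real.log m ^ (3 / 4 : ℝ)) ≤
          ∫ ω, (intervalSurplus (fun u => h u ω) o (a + 1) (a + T) : ℝ) ∂P := by
  -- Above `m₀` the multiscale bound applies. Below it `log m` is bounded, so the bound linear in
  -- `m` suffices after shrinking `c`.
  set m₀ := max (Real.exp 9) C with hm₀
  have hm9 : Real.exp 9 ≤ m₀ := le_max_left _ _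
  have hm0 : 0 < m₀ := (Real.exp_pos _).trans_le hm9
  have hlog : 0 < Real.log m₀ := by
    have := (Real.le_log_iff_exp_le hm0).2 hm9
    linarith
  refine ⟨min (1 / 512) (3 / 16 / Real.log m₀ ^ (3 / 4 : ℝ)), by positivity, ?_⟩
  intro U Ω _ P _ n R h o hh ho hinj a T t ht haT htn m hRC hm hm1
  have hml : 0 ≤ Real.log m := Real.log_nonneg hm1
  rcases le_total m₀ m with hmm | hmm
  · refine le_trans ?_ (integral_intervalSurplus_ge_of_large hh ho hinj ht haT htn hRC hm
      (hm9.trans hmm) ((le_max_right _ _).trans hmm))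
    gcongr
    exact min_le_left _ _
  · have hv : 1 ≤ (t : ℝ) * R / n := by
      rw [hm] at hm1
      exact Real.one_le_sqrt.1 hm1
    refine le_trans ?_ (integral_intervalSurplus_ge_sqrt hh ho hinj ht haT htn hv)
    rw [← hm]
    calc min (1 / 512) (3 / 16 / Real.log m₀ ^ (3 / 4 : ℝ)) * (m * Real.log m ^ (3 / 4 : ℝ))
        ≤ 3 / 16 / Real.log m₀ ^ (3 / 4 : ℝ) * (m * Real.log m₀ ^ (3 / 4 : ℝ)) := by
          gcongr
          exact min_le_right _ _
      _ = 3 / 16 * m := by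
          have : Real.log m₀ ^ (3 / 4 : ℝ) ≠ 0 := (Real.rpow_pos_of_pos hlog _).ne'
          field_simp

/-- Once `ε n < 1 / 2` and `n ≥ 4`, one has `t ≤ √n ≤ n / 2`. This is the only use of `t = n ^
o(1)`. -/
theorem eventually_two_mul_le {ε : ℕ → ℝ} (hε : Tendsto ε atTop (𝓝 0)) :
    ∀ᶠ n : ℕ in atTop, ∀ t : ℕ, (t : ℝ) ≤ (n : ℝ) ^ ε n → 2 * t ≤ n := by
  filter_upwards [hε.eventually (gt_mem_nhds (by norm_num : (0 : ℝ) < 1 / 2)),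
    eventually_ge_atTop 4] with n hn hn4 t ht
  have hn4' : (4 : ℝ) ≤ n := by exact_mod_cast hn4
  have h1 : (n : ℝ) ^ ε n ≤ √n := by
    rw [Real.sqrt_eq_rpow]
    exact Real.rpow_le_rpow_of_exponent_le (by linarith) hn.le
  have h2 : (2 : ℝ) ≤ √n := Real.le_sqrt_of_sq_le (by linarith)
  have h3 : √(n : ℝ) * √n = n := Real.mul_self_sqrt (by linarith)
  have : (2 : ℝ) * t ≤ n := by nlinarith
  exact_mod_cast this

theorem mainTheorem7 (C : ℝ) :
    ∃ c : ℝ, 0 < c ∧ ∀ ε : ℕ → ℝ, Tendsto ε atTop (𝓝 0) →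
      ∀ᶠ n : ℕ in atTop, ∀ (R t : ℕ) (m : ℝ), (R : ℝ) ≤ C * n → (t : ℝ) ≤ (n : ℝ) ^ ε n →
        m = Real.sqrt ((t : ℝ) * R / n) → 1 ≤ m →
        ∀ (U : Type*) (Ω : Type*) [MeasurableSpace Ω] (P : Measure Ω) [IsProbabilityMeasure P]
          (h : U → Ω → Fin n) (o : Fin (2 * R) → Operation U),
          IsFullyRandomHash P n h → IsAlternating o →
          Function.Injective (fun k => (o k).key) →
          c * (m * Real.log m ^ (3 / 4 : ℝ)) ≤
              ∫ ω, (intervalSurplus (fun u => h u ω) o 1 t : ℝ) ∂P ∧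
            ∀ j : ℕ, t + 1 ≤ j → j ≤ n →
              c * (m * Real.log m ^ (3 / 4 : ℝ)) ≤
                ∫ ω, (intervalSurplus (fun u => h u ω) o (j - t) j : ℝ) ∂P := by
  obtain ⟨c, hc, hmain⟩ := exists_integral_intervalSurplus_ge C
  refine ⟨c, hc, fun ε hε => ?_⟩
  filter_upwards [eventually_two_mul_le hε] with n hn R t m hRC ht hm hm1 U Ω _ P _ h o hh ho hinj
  have htn := hn t ht
  refine ⟨?_, fun j hj hjn => ?_⟩
  · have := hmain hh ho hinj (a := 0) (T := t) le_rfl (by omega) htn hRC hm hm1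
    simpa only [zero_add] using this
  -- The interval `[j - t, j]` has `t + 1` slots, one more than the `t` that the bound needs.
  · have := hmain hh ho hinj (a := j - t - 1) (T := t + 1) (by omega) (by omega) htn hRC hm hm1
    rwa [show j - t - 1 + 1 = j - t by omega, show j - t - 1 + (t + 1) = j by omega] at this

end Main
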